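/- **Setting.** Let $U\subset\mathbb{R}^2$ be open and let $f:U\to\mathbb{RP}^3$ be a regular ($C^2$, immersed) parametrized surface with homogeneous coordinates $F:U\to\mathbb{R}^4\setminus\{0\}$. It is a *characteristic parametrization of a supercyclide* if it is conjugate ($\partial_1\partial_2F\in\operatorname{span}(F,\partial_1F,\partial_2F)$), each parameter line is contained in a non-degenerate conic, and along each parameter line the tangent planes of the surface envelop a quadratic cone. An *SC-patch* is the restriction of such an $f$ to a closed rectangle $[a_0,a_1]\times[b_0,b_1]\subset U$ with $a_0<a_1$, $b_0<b_1$. Its vertices are $x=f(a_0,b_0)$, $x_1=f(a_1,b_0)$, $x_{12}=f(a_1,b_1)$, $x_2=f(a_0,b_1)$. The $i$-th family of conics consists of the curves along which the $i$-th parameter varies; the *characteristic line* $a^i$ is the axis (common intersection) of the planes supporting the conics of the $i$-th family. The patch is *generic* if $a^1$ and $a^2$ are skew. The *tangents* $t^1,t^2$ at a vertex are the tangents to the two boundary curves meeting there. We say that the patch has *generic boundary* if, in each of the two families, the two opposite boundary curves lie in distinct planes and the tangent cones along them have distinct vertices. **Proposition (Properties of SC-patches).** For every generic SC-patch: (i)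 The vertices $x,x_1,x_{12},x_2$ are coplanar. (ii) Suppose the vertices are not collinear. Then the Laplace points $y^1=(x\vee x_1)\cap(x_2\vee x_{12})$ and $y^2=(x\vee x_2)\cap(x_1\vee x_{12})$ are well defined (each intersection is exactly one point), and isoparametric points on opposite boundary curves are perspective from the non-corresponding Laplace point: for every $v\in[b_0,b_1]$ the points $y^1,f(a_0,v),f(a_1,v)$ are distinct and collinear, and for every $u\in[a_0,a_1]$ the points $y^2,f(u,b_0),f(u,b_1)$ are distinct and collinear. (iii) For each direction $i=1,2$, the tangents $t^i$ at the four vertices $x,x_1,x_{12},x_2$ intersect cyclically (tangents at consecutive vertices have a common point). If the patch has generic boundary, the eight tangents form an elementary cube of a fundamental line complex. That is, place the two tangents at each vertex at the vertices of a combinatorial cube, whose first two directions are those of the vertex quadrilateral and whose third direction joins $t^1$ and $t^2$ at the same vertex. Then any two neighbouring lines intersect in exactly one point (a focal point), lines at opposite vertices of each face of the cube are skew, and for each of the three directions the four focal points are coplanar. (iv) The tangent planes at the four vertices are concurrent, i.e. have a common point; if the patch has generic boundary, they have exactly one common point. -/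

import Mathlib

open scoped LinearAlgebra.Projectivization
open Set Module

noncomputable section

/-- Homogeneous coordinate vectors of real projective 3-space. -/
abbrev Vec : Type := Fin 4 → ℝ

/-- Real projective 3-space. Lines and planes of it are the linear subspaces of `Vec` of
dimension 2 and 3; a point `x` lies on a subspace `W` when `x.submodule ≤ W`. -/
abbrev RP3 : Type := ℙ ℝ Vec

/-- The subspace spanned by two points (their connecting line, if they are distinct). -/
def join (x y : RP3) : Submodule ℝ Vec := x.submodule ⊔ y.submodule

/-- Two points are perspective from a centre: the three points are distinct and collinear. -/
def PerspectiveFrom (o x y : RP3) : Prop :=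
  x ≠ y ∧ o ≠ x ∧ o ≠ y ∧ o.submodule ≤ join x y

/-- A (non-degenerate, real, non-empty) conic in projective 3-space: the zero set, in some plane
`W`, of a quadratic form whose restriction to `W` is non-degenerate. -/
def IsConic (C : Set RP3) : Prop :=
  C.Nonempty ∧ ∃ (W : Submodule ℝ Vec) (Q : QuadraticForm ℝ Vec),
    finrank ℝ W = 3 ∧
    (∀ x ∈ W, (∀ y ∈ W, QuadraticMap.polar Q x y = 0) → x = 0) ∧
    C = {x : RP3 | x.submodule ≤ W ∧ Q x.rep = 0}

/-! ### Parametrized surfaces, in homogeneous coordinates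

A parametrized surface `f` is described by a lift `F` to homogeneous coordinates. All notions
below are unchanged when `F` is multiplied by a nowhere vanishing function. The coordinate
directions are indexed by `0` and `1`. -/

/-- Partial derivative in coordinate direction `k`. -/
def pd (k : Fin 2) (F : ℝ × ℝ → Vec) (p : ℝ × ℝ) : Vec :=
  fderiv ℝ F p (![((1 : ℝ), (0 : ℝ)), ((0 : ℝ), (1 : ℝ))] k)

/-- Tangent at `p` to the parameter line of direction `k`. -/
def tangentLine (F : ℝ × ℝ → Vec) (k : Fin 2) (p : ℝ × ℝ) : Submodule ℝ Vec :=
  Submodule.span ℝ {F p, pd k F p}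

/-- Tangent plane of the surface at `p`. -/
def tangentPlane (F : ℝ × ℝ → Vec) (p : ℝ × ℝ) : Submodule ℝ Vec :=
  Submodule.span ℝ {F p, pd 0 F p, pd 1 F p}

/-- The part in `S` of the parameter line of direction `k` through `p`: for `k = 0` the second
coordinate is constant, for `k = 1` the first coordinate is constant. -/
def paramLine (k : Fin 2) (S : Set (ℝ × ℝ)) (p : ℝ × ℝ) : Set (ℝ × ℝ) :=
  {q ∈ S | ![q.2, q.1] k = ![p.2, p.1] k}

/-- The tangent planes at the points of the curve `F '' L` envelop a quadratic cone: there is a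
quadratic form `Q` of rank 3 (its one-dimensional radical is the vertex of the cone `Q = 0`) such
that the curve lies on the cone and, at each point of the curve, the tangent plane of the surface
is the tangent (that is, polar) plane of the cone. -/
def TangentPlanesEnvelopCone (F : ℝ × ℝ → Vec) (L : Set (ℝ × ℝ)) : Prop :=
  ∃ Q : QuadraticForm ℝ Vec,
    finrank ℝ (LinearMap.ker (QuadraticMap.polarBilin Q)) = 1 ∧
    ∀ p ∈ L, Q (F p) = 0 ∧
      tangentPlane F p = LinearMap.ker (QuadraticMap.polarBilin Q (F p))

/-- `f`, with homogeneous coordinates `F`, is a characteristic parametrization of a supercyclide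
on the open set `U`: a regular conjugate parametrization all of whose parameter lines are (arcs of)
conics along which the tangent planes envelop quadratic cones. -/
structure IsCharacteristicParametrization
    (U : Set (ℝ × ℝ)) (f : ℝ × ℝ → RP3) (F : ℝ × ℝ → Vec) : Prop where
  isOpen : IsOpen U
  contDiffOn : ContDiffOn ℝ 2 F U
  lift : ∀ p ∈ U, ∃ h : F p ≠ 0, f p = Projectivization.mk ℝ (F p) h
  regular : ∀ p ∈ U, LinearIndependent ℝ ![F p, pd 0 F p, pd 1 F p]
  conjugate : ∀ p ∈ U, pd 0 (pd 1 F) p ∈ Submodule.span ℝ {F p, pd 0 F p, pd 1 F p}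
  conics : ∀ p ∈ U, ∀ k, ∃ C : Set RP3, IsConic C ∧ ∀ q ∈ paramLine k U p, f q ∈ C
  cones : ∀ p ∈ U, ∀ k, TangentPlanesEnvelopCone F (paramLine k U p)

/-- A parametrized supercyclidic patch: the restriction of a characteristic parametrization to a
closed rectangle `[a₀, a₁] × [b₀, b₁]` contained in its domain. -/
structure SCPatch where
  U : Set (ℝ × ℝ)
  f : ℝ × ℝ → RP3
  F : ℝ × ℝ → Vec
  characteristic : IsCharacteristicParametrization U f F
  a₀ : ℝ
  a₁ : ℝ
  b₀ : ℝ
  b₁ : ℝ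
  a_lt : a₀ < a₁
  b_lt : b₀ < b₁
  rect_subset : Icc a₀ a₁ ×ˢ Icc b₀ b₁ ⊆ U

namespace SCPatch

/-- The closed parameter rectangle. -/
def rect (P : SCPatch) : Set (ℝ × ℝ) := Icc P.a₀ P.a₁ ×ˢ Icc P.b₀ P.b₁

/-- The corners of the parameter rectangle. -/
def corner (P : SCPatch) (i j : Fin 2) : ℝ × ℝ := (![P.a₀, P.a₁] i, ![P.b₀, P.b₁] j)

/-- The vertices of the patch: in the usual notation, `x = vertex 0 0`, `x₁ = vertex 1 0`,
`x₁₂ = vertex 1 1` and `x₂ = vertex 0 1`. -/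
def vertex (P : SCPatch) (i j : Fin 2) : RP3 := P.f (P.corner i j)

/-- The supporting plane of the conic of family `k` through the point with parameter `p`. -/
def supportingPlane (P : SCPatch) (k : Fin 2) (p : ℝ × ℝ) : Submodule ℝ Vec :=
  Submodule.span ℝ (P.F '' paramLine k P.rect p)

/-- The `k`-th characteristic line: the axis of the pencil formed by the supporting planes of the
`k`-th family of conics, that is, the intersection of all these planes. -/
def characteristicLine (P : SCPatch) (k : Fin 2) : Submodule ℝ Vec :=
  ⨅ p ∈ P.rect, P.supportingPlane k p

/-- The characteristic lines are skew. -/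
def SkewCharacteristicLines (P : SCPatch) : Prop :=
  P.characteristicLine 0 ⊓ P.characteristicLine 1 = ⊥

/-- The vertex of the tangent cone along the conic of family `k` through the point with parameter
`p`: the common point of the tangent planes along that conic. -/
def coneVertex (P : SCPatch) (k : Fin 2) (p : ℝ × ℝ) : Submodule ℝ Vec :=
  ⨅ q ∈ paramLine k P.rect p, tangentPlane P.F q

/-- The two boundary curves of each family (these are the conics of that family through the
opposite corners `(0, 0)` and `(1, 1)`) lie in distinct planes, and the tangent cones along them
have distinct vertices. -/
def GenericBoundary (P : SCPatch) : Prop :=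
  ∀ k, P.supportingPlane k (P.corner 0 0) ≠ P.supportingPlane k (P.corner 1 1) ∧
    P.coneVertex k (P.corner 0 0) ≠ P.coneVertex k (P.corner 1 1)

/-- The vertices of the patch are not collinear. -/
def VerticesNotCollinear (P : SCPatch) : Prop :=
  ¬ ∃ l : Submodule ℝ Vec, finrank ℝ l = 2 ∧ ∀ i j, (P.vertex i j).submodule ≤ l

/-- Tangent at the vertex `(i, j)` to the boundary curve of direction `k`. -/
def tangent (P : SCPatch) (k i j : Fin 2) : Submodule ℝ Vec :=
  tangentLine P.F k (P.corner i j)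

/-- The eight boundary tangents as a combinatorial cube: the first two cube coordinates are those
of the vertex, the third one is the direction of the tangent. -/
def tangentCube (P : SCPatch) (ε : Fin 3 → Fin 2) : Submodule ℝ Vec :=
  P.tangent (ε 2) (ε 0) (ε 1)

end SCPatch

/-- The neighbour in direction `i` of a vertex of the combinatorial cube. -/
def cubeFlip (i : Fin 3) (ε : Fin 3 → Fin 2) : Fin 3 → Fin 2 :=
  Function.update ε i (1 - ε i)

/-- Eight lines at the vertices of a combinatorial cube are an elementary cube of a fundamental
line complex: neighbouring lines intersect in one point (their focal point), lines at opposite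
vertices of a face are skew, and for each direction the four focal points are coplanar. -/
structure IsFundamentalLineComplexCube (l : (Fin 3 → Fin 2) → Submodule ℝ Vec) : Prop where
  lines : ∀ ε, finrank ℝ (l ε) = 2
  torsal : ∀ ε i, finrank ℝ (l ε ⊓ l (cubeFlip i ε) : Submodule ℝ Vec) = 1
  skew : ∀ ε i j, i ≠ j → l ε ⊓ l (cubeFlip j (cubeFlip i ε)) = ⊥
  focal_planar : ∀ i, ∃ W : Submodule ℝ Vec, finrank ℝ W = 3 ∧
    ∀ ε, l ε ⊓ l (cubeFlip i ε) ≤ W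

end

/-! ### Linear algebra: spans of two or three vectors, totally isotropic subspaces. -/

section LinearAlgebra

variable {V : Type*} [AddCommGroup V] [Module ℝ V]

/-! The proof rests on a normal form (`SCPatch.exists_coord`): up to a scalar factor, a generic
patch is F(u, v) ∼ a(u) + b(v), where a runs in the characteristic line A of family 0 and b in the
characteristic line B of family 1, complementary 2-dimensional subspaces of `Vec`. The tangents at
(u, v) join a(u) + b(v) to d(u) ∈ A and to c(v) ∈ B, the vertices of the cones along the conics u =
const and v = const.

Conjugacy and the rank of the cone force the cone vertex along a conic to lie on every conjugate
tangent (`IsConicArc.coneVertex_mem_conjugate`). It therefore lies in the planes of all conics of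
the other family, that is, on their axis. Tangents of a conic are not concurrent, so these vertices
span at least a line, and skewness leaves room for exactly one. The plane of a conic contains the
axis of its own family and meets the other axis in one point. Hence for fixed v the B-component of F
keeps its direction. The patch avoids both axes (`SCPatch.notMem_characteristicLine`), so this
component can be scaled to a constant; what remains is an A-component G_v(u) with velocity along
d(u). For different v the vectors G_v(u) are proportional, and since their velocities are parallel
to d(u) while they are not, the ratio does not depend on u (`exists_const_of_proportional`).
Absorbing it in the scale gives the normal form.

The rest is computation in A ⊕ B, with indices for the corners. The Laplace points are a₁ - a₀ and
b₁ - b₀. If w is the intersection of the affine lines a_i + ℝ d_i in A, and w' that of b_j + ℝ c_j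
in B, the focal points of the cube are w + b_j and c_j (in the plane B ⊔ w), a_i + w' and d_i (in A
⊔ w'), and the vertices. The tangent planes meet in w + w'; if d₀, d₁ or c₀, c₁ are proportional,
such a vector d or c is a common point instead. -/

theorem finrank_span_pair_of_linearIndependent {x y : V} (h : LinearIndependent ℝ ![x, y]) :
    finrank ℝ (Submodule.span ℝ {x, y}) = 2 := by
  have := finrank_span_eq_card h
  have e : Set.range ![x, y] = {x, y} := by
    ext w; simp [Matrix.range_cons, Matrix.range_empty]; tauto
  rw [e] at this
  simpa using this

theorem linearIndependent_pair_of_notMem {x y : V} (hx : x ≠ 0)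
    (hy : y ∉ Submodule.span ℝ {x}) : LinearIndependent ℝ ![x, y] := by
  rw [LinearIndependent.pair_iff' hx]
  intro a ha
  exact hy (Submodule.mem_span_singleton.2 ⟨a, ha⟩)

theorem notMem_span_of_linearIndependent_pair {x y : V} (h : LinearIndependent ℝ ![x, y]) :
    y ∉ Submodule.span ℝ {x} := by
  intro hy
  obtain ⟨a, ha⟩ := Submodule.mem_span_singleton.1 hy
  have := LinearIndependent.pair_iff.1 h a (-1) (by rw [ha]; simp)
  simp at this

theorem mem_span_pair_of_dependent {x y z : V} (h : LinearIndependent ℝ ![x, y])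
    (h' : ¬ LinearIndependent ℝ ![x, y, z]) : z ∈ Submodule.span ℝ {x, y} := by
  by_contra hz
  apply h'
  rw [LinearIndependent.pair_iff] at h
  rw [Fintype.linearIndependent_iff]
  intro g hg
  simp only [Fin.sum_univ_three, Matrix.cons_val_zero, Matrix.cons_val_one,
    Matrix.cons_val] at hg
  have h2 : g 2 = 0 := by
    by_contra hne
    apply hz
    rw [Submodule.mem_span_pair]
    refine ⟨-(g 2)⁻¹ * g 0, -(g 2)⁻¹ * g 1, ?_⟩
    have : g 2 • z = -(g 0 • x + g 1 • y) := by
      rw [eq_neg_iff_add_eq_zero, ← hg]; abel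
    rw [← inv_smul_smul₀ hne z, this, smul_neg, smul_add, smul_smul, smul_smul, neg_mul, neg_mul,
      neg_smul, neg_smul, neg_add]
  rw [h2, zero_smul, add_zero] at hg
  have := h _ _ hg
  intro i
  fin_cases i
  · exact this.1
  · exact this.2
  · exact h2

theorem span_pair_eq_of_linearIndependent {W : Submodule ℝ V} [FiniteDimensional ℝ W]
    (hW : finrank ℝ W = 2) {x y : V} (h : LinearIndependent ℝ ![x, y]) (hx : x ∈ W) (hy : y ∈ W) :
    Submodule.span ℝ {x, y} = W :=
  Submodule.eq_of_le_of_finrank_eq (Submodule.span_le.2 (by rintro _ (rfl | rfl) <;> assumption))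
    (by rw [finrank_span_pair_of_linearIndependent h, hW])

theorem span_triple_eq_of_notMem {W : Submodule ℝ V} [FiniteDimensional ℝ W]
    (hW : finrank ℝ W = 3) {x y z : V} (h : LinearIndependent ℝ ![x, y]) (hx : x ∈ W) (hy : y ∈ W)
    (hz : z ∈ W) (hn : z ∉ Submodule.span ℝ {x, y}) : Submodule.span ℝ {x, y, z} = W := by
  have hli : LinearIndependent ℝ ![x, y, z] := by
    by_contra hc
    exact hn (mem_span_pair_of_dependent h hc)
  have hr : finrank ℝ (Submodule.span ℝ {x, y, z}) = 3 := by
    have := finrank_span_eq_card hli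
    have e : Set.range ![x, y, z] = {x, y, z} := by
      ext w; simp [Matrix.range_cons, Matrix.range_empty]; tauto
    rw [e] at this
    simpa using this
  exact Submodule.eq_of_le_of_finrank_eq
    (Submodule.span_le.2 (by rintro _ (rfl | rfl | rfl) <;> assumption)) (by rw [hr, hW])

theorem finrank_span_pair_le (x y : V) : finrank ℝ (Submodule.span ℝ {x, y}) ≤ 2 := by
  classical
  have h := (finrank_span_finset_le_card (R := ℝ) ({x, y} : Finset V)).trans Finset.card_le_two
  rwa [Set.finrank, Finset.coe_pair] at h

theorem exists_mem_notMem_span_pair {W : Submodule ℝ V} (hW : 3 ≤ finrank ℝ W) (x y : V) :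
    ∃ z ∈ W, z ∉ Submodule.span ℝ {x, y} := by
  by_contra! hc
  have hle : W ≤ Submodule.span ℝ {x, y} := hc
  have : FiniteDimensional ℝ (Submodule.span ℝ {x, y}) :=
    FiniteDimensional.span_of_finite ℝ (Set.toFinite _)
  exact absurd (hW.trans ((Submodule.finrank_mono hle).trans (finrank_span_pair_le x y)))
    (by norm_num)

/-- A symmetric bilinear form that is non-degenerate on a three-dimensional space has no totally
isotropic plane. -/
theorem not_isotropic_pair {W : Submodule ℝ V} [FiniteDimensional ℝ W] (hW : finrank ℝ W = 3)
    {B : V →ₗ[ℝ] V →ₗ[ℝ] ℝ} (hB : ∀ x y, B x y = B y x)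
    (hnd : ∀ x ∈ W, (∀ y ∈ W, B x y = 0) → x = 0) {x y : V} (hx : x ∈ W) (hy : y ∈ W)
    (hli : LinearIndependent ℝ ![x, y]) (hxx : B x x = 0) (hxy : B x y = 0) (hyy : B y y = 0) :
    False := by
  obtain ⟨z, hzW, hz⟩ := exists_mem_notMem_span_pair hW.ge x y
  have hspan := span_triple_eq_of_notMem hW hli hx hy hzW hz
  have key : ∀ w, B w x = 0 → B w y = 0 → B w z = 0 → ∀ v ∈ W, B w v = 0 := by
    intro w h1 h2 h3 v hv
    rw [← hspan, Submodule.mem_span_triple] at hv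
    obtain ⟨a, b, c, rfl⟩ := hv
    simp [h1, h2, h3]
  have hyx : B y x = 0 := by rw [hB, hxy]
  -- This combination is orthogonal to x and y by isotropy, and its coefficients make it orthogonal
  -- to z as well.
  have hw : B y z • x + (-(B x z)) • y = 0 := by
    apply hnd _ (W.add_mem (W.smul_mem _ hx) (W.smul_mem _ hy))
    apply key <;> simp [hxx, hxy, hyy, hyx]
    ring
  have h0 := LinearIndependent.pair_iff.1 hli _ _ hw
  have hx0 : x = 0 := hnd x hx (key x hxx hxy (by simpa using h0.2))
  exact hli.ne_zero 0 (by simpa using hx0)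

/-- A symmetric bilinear form with one-dimensional radical on a four-dimensional space has no
totally isotropic three-dimensional subspace. -/
theorem not_isotropic_triple [FiniteDimensional ℝ V] (hV : finrank ℝ V = 4)
    {B : V →ₗ[ℝ] V →ₗ[ℝ] ℝ} (hB : ∀ x y, B x y = B y x) {c : V}
    (hker : LinearMap.ker B = Submodule.span ℝ {c}) {x y : V}
    (hli : LinearIndependent ℝ ![c, x]) (hy : y ∉ Submodule.span ℝ {c, x})
    (hxx : B x x = 0) (hxy : B x y = 0) (hyy : B y y = 0) : False := by
  have hli3 : LinearIndependent ℝ ![c, x, y] := by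
    by_contra hc
    exact hy (mem_span_pair_of_dependent hli hc)
  have hr : finrank ℝ (Submodule.span ℝ {c, x, y}) = 3 := by
    have := finrank_span_eq_card hli3
    have e : Set.range ![c, x, y] = {c, x, y} := by
      ext w; simp [Matrix.range_cons, Matrix.range_empty]; tauto
    rw [e] at this
    simpa using this
  obtain ⟨z, hz⟩ : ∃ z, z ∉ Submodule.span ℝ {c, x, y} := by
    by_contra! hc
    have : Submodule.span ℝ {c, x, y} = ⊤ := eq_top_iff.2 fun v _ => hc v
    rw [this, finrank_top, hV] at hr
    omega
  have htop : Submodule.span ℝ {c, x, y} ⊔ Submodule.span ℝ {z} = ⊤ := by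
    apply Submodule.eq_top_of_finrank_eq
    have hlt : Submodule.span ℝ {c, x, y} < Submodule.span ℝ {c, x, y} ⊔ Submodule.span ℝ {z} :=
      lt_of_le_of_ne le_sup_left fun he => hz (by
        rw [he]; exact Submodule.mem_sup_right (Submodule.mem_span_singleton_self z))
    have h1 := Submodule.finrank_lt_finrank_of_lt hlt
    have h2 := Submodule.finrank_le (Submodule.span ℝ {c, x, y} ⊔ Submodule.span ℝ {z})
    omega
  have hc0 : B c = 0 := by
    have : c ∈ LinearMap.ker B := hker ▸ Submodule.mem_span_singleton_self c
    simpa using this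
  have key : ∀ w, B w x = 0 → B w y = 0 → B w z = 0 → w ∈ Submodule.span ℝ {c} := by
    intro w h1 h2 h3
    rw [← hker, LinearMap.mem_ker]
    ext v
    have hv : v ∈ Submodule.span ℝ {c, x, y} ⊔ Submodule.span ℝ {z} := htop ▸ Submodule.mem_top
    obtain ⟨p, hp, q, hq, rfl⟩ := Submodule.mem_sup.1 hv
    obtain ⟨a, b, e, rfl⟩ := Submodule.mem_span_triple.1 hp
    obtain ⟨g, rfl⟩ := Submodule.mem_span_singleton.1 hq
    have h4 : B w c = 0 := by rw [hB, hc0]; rfl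
    simp [h1, h2, h3, h4]
  have hyx : B y x = 0 := by rw [hB, hxy]
  -- The combination of x and y orthogonal to z lies in the radical, so it is a multiple of c;
  -- independence of c, x, y then yields B x z = 0 and puts x itself in the radical.
  obtain ⟨e, he⟩ := Submodule.mem_span_singleton.1
    (key (B y z • x + (-(B x z)) • y) (by simp [hxx, hyx]) (by simp [hxy, hyy]) (by simp; ring))
  have h3 := Fintype.linearIndependent_iff.1 hli3 ![-e, B y z, -(B x z)] (by
    simp only [Fin.sum_univ_three, Matrix.cons_val_zero, Matrix.cons_val_one, Matrix.cons_val]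
    rw [neg_smul, he]; abel)
  have hxk := key x hxx hxy (by simpa using h3 2)
  exact notMem_span_of_linearIndependent_pair hli hxk

end LinearAlgebra

/-! ### Differentiation along arcs; conic arcs and the cones enveloped along them. -/

section Curves

variable {V : Type*} [NormedAddCommGroup V] [NormedSpace ℝ V] [FiniteDimensional ℝ V]

theorem mem_submodule_of_hasDerivWithinAt {l r s : ℝ} (hlr : l < r) (hs : s ∈ Icc l r)
    {γ : ℝ → V} {γ' : V} (hγ : HasDerivWithinAt γ γ' (Icc l r) s) {W : Submodule ℝ V}
    (hW : ∀ t ∈ Icc l r, γ t ∈ W) : γ' ∈ W := by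
  obtain ⟨W', hWW'⟩ := W.exists_isCompl
  set L : V →ₗ[ℝ] V := W'.projection W hWW'.symm
  have h1 : HasDerivWithinAt (fun t => L.toContinuousLinearMap (γ t)) (L.toContinuousLinearMap γ')
      (Icc l r) s := L.toContinuousLinearMap.hasFDerivAt.comp_hasDerivWithinAt s hγ
  have h2 : HasDerivWithinAt (fun t => L.toContinuousLinearMap (γ t)) 0 (Icc l r) s := by
    refine (hasDerivWithinAt_const s (Icc l r) (0 : V)).congr (fun t ht => ?_) ?_
    · exact (Submodule.projection_apply_eq_zero_iff hWW'.symm).2 (hW t ht)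
    · exact (Submodule.projection_apply_eq_zero_iff hWW'.symm).2 (hW s hs)
  have h3 := (uniqueDiffOn_Icc hlr).uniqueDiffWithinAt hs |>.eq_deriv _ h1 h2
  exact (Submodule.projection_apply_eq_zero_iff hWW'.symm).1 h3

theorem bilin_deriv_eq_zero {l r s : ℝ} (hlr : l < r) (hs : s ∈ Icc l r)
    {γ η : ℝ → V} {γ' η' : V} (hγ : HasDerivWithinAt γ γ' (Icc l r) s)
    (hη : HasDerivWithinAt η η' (Icc l r) s) (B : V →ₗ[ℝ] V →ₗ[ℝ] ℝ)
    (h : ∀ t ∈ Icc l r, B (γ t) (η t) = 0) : B (γ s) η' + B γ' (η s) = 0 := by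
  have h1 := B.toContinuousBilinearMap.hasDerivWithinAt_of_bilinear hγ hη
  have h2 : HasDerivWithinAt (fun x => B.toContinuousBilinearMap (γ x) (η x)) 0 (Icc l r) s :=
    (hasDerivWithinAt_const s (Icc l r) (0 : ℝ)).congr (fun t ht => h t ht) (h s hs)
  exact (uniqueDiffOn_Icc hlr).uniqueDiffWithinAt hs |>.eq_deriv _ h1 h2

/-- Differentiating the proportionality of two vector functions. -/
theorem exists_deriv_eq_of_proportional {l r s : ℝ} (hlr : l < r) (hs : s ∈ Icc l r)
    {G H : ℝ → V} {G' H' : V} (hG : HasDerivWithinAt G G' (Icc l r) s)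
    (hH : HasDerivWithinAt H H' (Icc l r) s)
    (hGH : ∀ t ∈ Icc l r, ∃ e, G t ∈ Submodule.span ℝ {e} ∧ H t ∈ Submodule.span ℝ {e})
    (hs0 : H s ≠ 0) {ρ : ℝ}
    (hρ : G s = ρ • H s) : ∃ κ : ℝ, G' = ρ • H' + κ • H s := by
  obtain ⟨m, hm⟩ : ∃ m : V →ₗ[ℝ] ℝ, m (H s) ≠ 0 := by
    by_contra! hc
    exact hs0 ((Module.forall_dual_apply_eq_zero_iff ℝ (H s)).1 hc)
  set M := m.toContinuousLinearMap
  have hMG : HasDerivWithinAt (fun t => M (G t)) (M G') (Icc l r) s :=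
    M.hasFDerivAt.comp_hasDerivWithinAt s hG
  have hMH : HasDerivWithinAt (fun t => M (H t)) (M H') (Icc l r) s :=
    M.hasFDerivAt.comp_hasDerivWithinAt s hH
  have h1 := (hMH.smul hG).sub (hMG.smul hH)
  -- A form of proportionality without division, since H may vanish away from s and the common
  -- direction e may vary with t.
  have hz : ∀ t ∈ Icc l r, M (H t) • G t - M (G t) • H t = 0 := by
    intro t ht
    obtain ⟨e, he1, he2⟩ := hGH t ht
    obtain ⟨a, ha⟩ := Submodule.mem_span_singleton.1 he1
    obtain ⟨b, hb⟩ := Submodule.mem_span_singleton.1 he2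
    rw [← ha, ← hb, map_smul, map_smul, smul_smul, smul_smul, smul_eq_mul, smul_eq_mul,
      mul_right_comm, mul_right_comm a, mul_comm b, sub_self]
  have h2 := (hasDerivWithinAt_const s (Icc l r) (0 : V)).congr hz (hz s hs)
  have h3 := (uniqueDiffOn_Icc hlr).uniqueDiffWithinAt hs |>.eq_deriv _ h1 h2
  have hm' : M (H s) ≠ 0 := hm
  refine ⟨(M (H s))⁻¹ * (M G' - ρ * M H'), ?_⟩
  rw [hρ, map_smul] at h3
  have h4 : M (H s) • G' = M (H s) • (ρ • H') + (M G' - ρ * M H') • H s := by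
    rw [← sub_eq_zero, ← h3]; simp only [smul_eq_mul]; module
  calc G' = (M (H s))⁻¹ • (M (H s) • G') := (inv_smul_smul₀ hm' G').symm
    _ = _ := by rw [h4, smul_add, inv_smul_smul₀ hm', smul_smul]

/-- With G = ρ H, the term ρ' H is a difference of multiples of d. As H is nowhere parallel to d, ρ'
= 0. Differentiability of ρ is not given; it comes from writing ρ locally as a quotient of scalar
functions. -/
theorem exists_const_of_proportional {l r : ℝ} (hlr : l < r) {G H G' H' d : ℝ → V}
    (hG : ∀ s ∈ Icc l r, HasDerivWithinAt G (G' s) (Icc l r) s)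
    (hH : ∀ s ∈ Icc l r, HasDerivWithinAt H (H' s) (Icc l r) s)
    (hGH : ∀ s ∈ Icc l r, G s ∈ Submodule.span ℝ {H s})
    (hG' : ∀ s ∈ Icc l r, G' s ∈ Submodule.span ℝ {d s})
    (hH' : ∀ s ∈ Icc l r, H' s ∈ Submodule.span ℝ {d s})
    (hHd : ∀ s ∈ Icc l r, H s ∉ Submodule.span ℝ {d s}) :
    ∃ R : ℝ, ∀ s ∈ Icc l r, G s = R • H s := by
  choose! ρ hρ using fun s hs => Submodule.mem_span_singleton.1 (hGH s hs)
  have hder : ∀ s ∈ Icc l r, HasDerivWithinAt ρ 0 (Icc l r) s := by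
    intro s hs
    have hs0 : H s ≠ 0 := fun h => hHd s hs (h ▸ Submodule.zero_mem _)
    obtain ⟨κ, hκ⟩ := exists_deriv_eq_of_proportional hlr hs (hG s hs) (hH s hs)
      (fun t ht => ⟨H t, hGH t ht, Submodule.mem_span_singleton_self _⟩) hs0 (hρ s hs).symm
    have hκ0 : κ = 0 := by
      by_contra hne
      apply hHd s hs
      have : κ • H s ∈ Submodule.span ℝ {d s} := by
        rw [← sub_eq_iff_eq_add'.2 hκ]
        exact Submodule.sub_mem _ (hG' s hs) (Submodule.smul_mem _ _ (hH' s hs))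
      exact (Submodule.smul_mem_iff _ hne).1 this
    rw [hκ0, zero_smul, add_zero] at hκ
    obtain ⟨m, hm⟩ : ∃ m : V →ₗ[ℝ] ℝ, m (H s) ≠ 0 := by
      by_contra! hc
      exact hs0 ((Module.forall_dual_apply_eq_zero_iff ℝ (H s)).1 hc)
    set M := m.toContinuousLinearMap
    have hm' : M (H s) ≠ 0 := hm
    have hMG : HasDerivWithinAt (fun t => M (G t)) (M (G' s)) (Icc l r) s :=
      M.hasFDerivAt.comp_hasDerivWithinAt s (hG s hs)
    have hMH : HasDerivWithinAt (fun t => M (H t)) (M (H' s)) (Icc l r) s :=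
      M.hasFDerivAt.comp_hasDerivWithinAt s (hH s hs)
    have hq := hMG.div hMH hm'
    have hval : (M (G' s) * M (H s) - M (G s) * M (H' s)) / M (H s) ^ 2 = 0 := by
      rw [hκ, ← hρ s hs, map_smul, map_smul]
      simp only [smul_eq_mul]
      rw [div_eq_zero_iff]; left; ring
    rw [hval] at hq
    have hev : ∀ᶠ t in nhdsWithin s (Icc l r), M (H t) ≠ 0 :=
      hMH.continuousWithinAt.eventually_ne hm'
    have he : ∀ t ∈ Icc l r, M (H t) ≠ 0 → ρ t = M (G t) / M (H t) := by
      intro t ht hne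
      rw [← hρ t ht, map_smul, smul_eq_mul, mul_div_assoc, div_self hne, mul_one]
    refine hq.congr_of_eventuallyEq ?_ (he s hs hm')
    filter_upwards [hev, self_mem_nhdsWithin] with t h1 h2 using he t h2 h1
  refine ⟨ρ l, fun s hs => ?_⟩
  rw [← hρ s hs, constant_of_derivWithin_zero (fun s hs => (hder s hs).differentiableWithinAt)
    (fun x hx => (hder x (Ico_subset_Icc_self hx)).derivWithin
      ((uniqueDiffOn_Icc hlr).uniqueDiffWithinAt (Ico_subset_Icc_self hx))) s hs]

/-- An immersed arc of a non-degenerate conic, as a curve of homogeneous coordinate vectors; the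
conic is the zero set of the quadratic form of `B` in the plane `W`. -/
structure IsConicArc (l r : ℝ) (γ γ' : ℝ → V) (W : Submodule ℝ V)
    (B : V →ₗ[ℝ] V →ₗ[ℝ] ℝ) : Prop where
  lt : l < r
  deriv : ∀ s ∈ Icc l r, HasDerivWithinAt γ (γ' s) (Icc l r) s
  indep : ∀ s ∈ Icc l r, LinearIndependent ℝ ![γ s, γ' s]
  finrank_eq : finrank ℝ W = 3
  symm : ∀ x y, B x y = B y x
  nondeg : ∀ x ∈ W, (∀ y ∈ W, B x y = 0) → x = 0
  mem : ∀ s ∈ Icc l r, γ s ∈ W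
  isotropic : ∀ s ∈ Icc l r, B (γ s) (γ s) = 0

namespace IsConicArc

variable {l r : ℝ} {γ γ' : ℝ → V} {W : Submodule ℝ V} {B : V →ₗ[ℝ] V →ₗ[ℝ] ℝ}

theorem deriv_mem (h : IsConicArc l r γ γ' W B) {s : ℝ} (hs : s ∈ Icc l r) : γ' s ∈ W :=
  mem_submodule_of_hasDerivWithinAt h.lt hs (h.deriv s hs) h.mem

theorem apply_deriv (h : IsConicArc l r γ γ' W B) {s : ℝ} (hs : s ∈ Icc l r) :
    B (γ s) (γ' s) = 0 := by
  have := bilin_deriv_eq_zero h.lt hs (h.deriv s hs) (h.deriv s hs) B h.isotropic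
  rw [h.symm (γ' s)] at this
  linarith

/-- The tangent of a conic meets the conic only at its point of contact. -/
theorem mem_span_of_mem_tangent (h : IsConicArc l r γ γ' W B) {s t : ℝ} (hs : s ∈ Icc l r)
    (ht : t ∈ Icc l r) (hst : γ t ∈ Submodule.span ℝ {γ s, γ' s}) :
    γ t ∈ Submodule.span ℝ {γ s} := by
  obtain ⟨a, b, hab⟩ := Submodule.mem_span_pair.1 hst
  have h1 := h.isotropic t ht
  have h2 := h.isotropic s hs
  have h3 := h.apply_deriv hs
  have h4 : B (γ' s) (γ s) = 0 := by rw [h.symm, h3]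
  rw [← hab] at h1
  simp only [map_add, map_smul, LinearMap.add_apply, LinearMap.smul_apply, h2, h3, h4,
    smul_eq_mul, mul_zero, zero_add, add_zero] at h1
  rcases mul_eq_zero.1 h1 with hb | hb
  · rw [← hab, hb, zero_smul, add_zero]
    exact Submodule.smul_mem _ _ (Submodule.mem_span_singleton_self _)
  · rcases mul_eq_zero.1 hb with hb | hb
    · rw [← hab, hb, zero_smul, add_zero]
      exact Submodule.smul_mem _ _ (Submodule.mem_span_singleton_self _)
    · exact (not_isotropic_pair h.finrank_eq h.symm h.nondeg (h.mem s hs) (h.deriv_mem hs)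
        (h.indep s hs) h2 h3 hb).elim

/-- An arc contained in its tangent at l would consist of multiples of γ l only, and then γ' l would
be one too. So even a short arc determines the plane of its conic. -/
theorem span_image_eq (h : IsConicArc l r γ γ' W B) :
    Submodule.span ℝ (γ '' Icc l r) = W := by
  have hl : l ∈ Icc l r := left_mem_Icc.2 h.lt.le
  set S := Submodule.span ℝ (γ '' Icc l r)
  have hmem : ∀ s ∈ Icc l r, γ s ∈ S := fun s hs => Submodule.subset_span ⟨s, hs, rfl⟩
  have hd : γ' l ∈ S := mem_submodule_of_hasDerivWithinAt h.lt hl (h.deriv l hl) hmem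
  have hSW : S ≤ W := Submodule.span_le.2 (by rintro _ ⟨s, hs, rfl⟩; exact h.mem s hs)
  obtain ⟨t, ht, hn⟩ : ∃ t ∈ Icc l r, γ t ∉ Submodule.span ℝ {γ l, γ' l} := by
    by_contra! hc
    have : γ' l ∈ Submodule.span ℝ {γ l} :=
      mem_submodule_of_hasDerivWithinAt h.lt hl (h.deriv l hl)
        fun t ht => h.mem_span_of_mem_tangent hl ht (hc t ht)
    exact notMem_span_of_linearIndependent_pair (h.indep l hl) this
  refine le_antisymm hSW ?_
  rw [← span_triple_eq_of_notMem h.finrank_eq (h.indep l hl) (h.mem l hl) (h.deriv_mem hl)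
    (h.mem t ht) hn, Submodule.span_le]
  rintro _ (rfl | rfl | rfl)
  · exact hmem l hl
  · exact hd
  · exact hmem t ht

/-- The tangents of a conic are not concurrent in the plane of the conic. -/
theorem eq_zero_of_mem_tangent (h : IsConicArc l r γ γ' W B) {c : V} (hcW : c ∈ W)
    (hc : ∀ s ∈ Icc l r, c ∈ Submodule.span ℝ {γ s, γ' s}) : c = 0 := by
  -- Each tangent is orthogonal to its point of contact, so c is orthogonal to the whole arc, which
  -- spans W.
  have h1 : ∀ s ∈ Icc l r, B c (γ s) = 0 := by
    intro s hs
    obtain ⟨a, b, hab⟩ := Submodule.mem_span_pair.1 (hc s hs)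
    rw [h.symm, ← hab]
    simp [h.isotropic s hs, h.apply_deriv hs]
  refine h.nondeg c hcW fun y hy => ?_
  have hle : W ≤ LinearMap.ker (B c) := by
    rw [← h.span_image_eq, Submodule.span_le]
    rintro _ ⟨s, hs, rfl⟩
    exact h1 s hs
  exact hle hy

variable {B₂ : V →ₗ[ℝ] V →ₗ[ℝ] ℝ} {c : V}

/-- A conic on a quadratic cone does not pass through the vertex of the cone. -/
theorem coneVertex_notMem (h : IsConicArc l r γ γ' W B) (hV : finrank ℝ V = 4)
    (hB₂ : ∀ x y, B₂ x y = B₂ y x) (hker : LinearMap.ker B₂ = Submodule.span ℝ {c}) (hc : c ≠ 0)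
    (hiso : ∀ s ∈ Icc l r, B₂ (γ s) (γ s) = 0) (hne : ∀ s ∈ Icc l r, B₂ (γ s) ≠ 0) : c ∉ W := by
  intro hcW
  apply hc
  refine h.eq_zero_of_mem_tangent hcW fun s hs => ?_
  have hc0 : B₂ c = 0 := by
    have : c ∈ LinearMap.ker B₂ := hker ▸ Submodule.mem_span_singleton_self c
    simpa using this
  have hd : B₂ (γ s) (γ' s) = 0 := by
    have := bilin_deriv_eq_zero h.lt hs (h.deriv s hs) (h.deriv s hs) B₂ hiso
    rw [hB₂ (γ' s)] at this
    linarith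
  -- If c is off the tangent at s, then γ s, γ' s, c span W and W is orthogonal to γ s for the cone
  -- form. Any γ t outside span {c, γ s} would then complete a totally isotropic triple, so the arc
  -- would lie on a line.
  by_contra hn
  have hspan := span_triple_eq_of_notMem h.finrank_eq (h.indep s hs) (h.mem s hs)
    (h.deriv_mem hs) hcW hn
  have hW : ∀ w ∈ W, B₂ (γ s) w = 0 := by
    intro w hw
    rw [← hspan, Submodule.mem_span_triple] at hw
    obtain ⟨x, y, z, rfl⟩ := hw
    have : B₂ (γ s) c = 0 := by rw [hB₂, hc0]; rfl
    simp [hiso s hs, hd, this]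
  have hli : LinearIndependent ℝ ![c, γ s] := by
    apply linearIndependent_pair_of_notMem hc
    rw [← hker]
    exact hne s hs
  obtain ⟨z, hz, hzn⟩ := exists_mem_notMem_span_pair h.finrank_eq.ge c (γ s)
  rw [← h.span_image_eq] at hz
  have hle : Submodule.span ℝ (γ '' Icc l r) ≤ Submodule.span ℝ {c, γ s} := by
    rw [Submodule.span_le]
    rintro _ ⟨t, ht, rfl⟩
    by_contra hnt
    exact not_isotropic_triple hV hB₂ hker hli hnt (hiso s hs) (hW _ (h.mem t ht)) (hiso t ht)
  exact hzn (hle hz)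

/-- The vertex of the cone enveloped by the tangent planes along a conic lies on the conjugate
tangents. -/
theorem coneVertex_mem_conjugate (h : IsConicArc l r γ γ' W B) (hV : finrank ℝ V = 4)
    (hB₂ : ∀ x y, B₂ x y = B₂ y x) (hker : LinearMap.ker B₂ = Submodule.span ℝ {c}) (hc : c ≠ 0)
    {η η' : ℝ → V} (hη : ∀ s ∈ Icc l r, HasDerivWithinAt η (η' s) (Icc l r) s)
    (hη' : ∀ s ∈ Icc l r, η' s ∈ Submodule.span ℝ {γ s, γ' s, η s})
    (hT : ∀ s ∈ Icc l r, Submodule.span ℝ {γ s, γ' s, η s} = LinearMap.ker (B₂ (γ s)))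
    (hne : ∀ s ∈ Icc l r, B₂ (γ s) ≠ 0) :
    ∀ s ∈ Icc l r, c ∈ Submodule.span ℝ {γ s, η s} := by
  intro s hs
  have hmem : ∀ t ∈ Icc l r, ∀ x ∈ Submodule.span ℝ {γ t, γ' t, η t}, B₂ (γ t) x = 0 := by
    intro t ht x hx
    rw [hT t ht] at hx
    exact hx
  have hiso : ∀ t ∈ Icc l r, B₂ (γ t) (γ t) = 0 :=
    fun t ht => hmem t ht _ (Submodule.subset_span (by simp))
  have hcW := h.coneVertex_notMem hV hB₂ hker hc hiso hne
  have hc0 : B₂ c = 0 := by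
    have : c ∈ LinearMap.ker B₂ := hker ▸ Submodule.mem_span_singleton_self c
    simpa using this
  have hd : B₂ (γ s) (γ' s) = 0 := hmem s hs _ (Submodule.subset_span (by simp))
  -- The derivative of B₂ γ η = 0; the term B₂ γ η' vanishes because conjugacy puts η' in the
  -- tangent plane.
  have h1 : B₂ (γ' s) (η s) = 0 := by
    have := bilin_deriv_eq_zero h.lt hs (h.deriv s hs) (hη s hs) B₂
      fun t ht => hmem t ht _ (Submodule.subset_span (by simp))
    rwa [hmem s hs _ (hη' s hs), zero_add] at this
  have hcT : c ∈ Submodule.span ℝ {γ s, γ' s, η s} := by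
    rw [hT s hs, LinearMap.mem_ker, hB₂, hc0]; rfl
  obtain ⟨x, y, z, hxyz⟩ := Submodule.mem_span_triple.1 hcT
  -- Pairing c = x γ + y γ' + z η with γ' leaves only the middle term. The second factor cannot
  -- vanish, since c, γ, γ' would then be totally isotropic.
  have h2 : y * B₂ (γ' s) (γ' s) = 0 := by
    have h3 : B₂ c (γ' s) = 0 := by rw [hc0]; rfl
    rw [← hxyz, hB₂] at h3
    simpa [h1, hB₂ (γ' s) (γ s), hd] using h3
  rcases mul_eq_zero.1 h2 with hy | hy
  · rw [hy, zero_smul, add_zero] at hxyz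
    exact Submodule.mem_span_pair.2 ⟨x, z, hxyz⟩
  · exfalso
    have hli : LinearIndependent ℝ ![c, γ s] := by
      apply linearIndependent_pair_of_notMem hc
      rw [← hker]
      exact hne s hs
    refine not_isotropic_triple hV hB₂ hker hli (fun hm => ?_) (hiso s hs) hd hy
    obtain ⟨a, b, hab⟩ := Submodule.mem_span_pair.1 hm
    by_cases ha : a = 0
    · rw [ha, zero_smul, zero_add] at hab
      exact notMem_span_of_linearIndependent_pair (h.indep s hs)
        (Submodule.mem_span_singleton.2 ⟨b, hab⟩)
    · apply hcW
      have : a • c ∈ W := by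
        rw [eq_sub_of_add_eq hab]
        exact W.sub_mem (h.deriv_mem hs) (W.smul_mem _ (h.mem s hs))
      exact (Submodule.smul_mem_iff _ ha).1 this

/-- The tangent planes along the conic have only the vertex of the cone in common. -/
theorem mem_span_coneVertex (h : IsConicArc l r γ γ' W B) (hV : finrank ℝ V = 4)
    (hB₂ : ∀ x y, B₂ x y = B₂ y x) (hker : LinearMap.ker B₂ = Submodule.span ℝ {c})
    (hcW : c ∉ W) {x : V} (hx : ∀ s ∈ Icc l r, B₂ (γ s) x = 0) : x ∈ Submodule.span ℝ {c} := by
  have hc0 : B₂ c = 0 := by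
    have : c ∈ LinearMap.ker B₂ := hker ▸ Submodule.mem_span_singleton_self c
    simpa using this
  have hle : W ≤ LinearMap.ker (B₂ x) := by
    rw [← h.span_image_eq, Submodule.span_le]
    rintro _ ⟨s, hs, rfl⟩
    rw [SetLike.mem_coe, LinearMap.mem_ker, hB₂, hx s hs]
  have hcx : c ∈ LinearMap.ker (B₂ x) := by rw [LinearMap.mem_ker, hB₂, hc0]; rfl
  -- The orthogonal space of x contains W and also c, which is outside W; hence it is everything.
  have hlt : W < LinearMap.ker (B₂ x) := lt_of_le_of_ne hle fun he => hcW (he ▸ hcx)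
  have h1 := Submodule.finrank_lt_finrank_of_lt hlt
  have h2 := Submodule.finrank_le (LinearMap.ker (B₂ x))
  have h3 : LinearMap.ker (B₂ x) = ⊤ := Submodule.eq_top_of_finrank_eq (by
    have := h.finrank_eq; omega)
  rw [← hker, LinearMap.mem_ker]
  exact LinearMap.ker_eq_top.1 h3

end IsConicArc

end Curves

/-! ### Homogeneous coordinates, parameter lines and partial derivatives. -/

theorem finrank_vec : finrank ℝ Vec = 4 := by simp

theorem mem_of_submodule_mk_le {x : RP3} {v : Vec} (h : v ≠ 0) (hx : x = Projectivization.mk ℝ v h)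
    {W : Submodule ℝ Vec} : x.submodule ≤ W ↔ v ∈ W := by
  rw [hx, Projectivization.submodule_mk, Submodule.span_singleton_le_iff_mem]

theorem quadraticForm_rep_eq_zero {x : RP3} {v : Vec} (h : v ≠ 0)
    (hx : x = Projectivization.mk ℝ v h) (Q : QuadraticForm ℝ Vec) (hQ : Q x.rep = 0) :
    Q v = 0 := by
  obtain ⟨a, ha⟩ := Projectivization.exists_smul_eq_mk_rep ℝ v h
  rw [hx, ← ha, Units.smul_def, QuadraticMap.map_smul] at hQ
  simpa using hQ

/-- The point with coordinate `s` on the parameter line of direction `k` through `p`. -/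
def linePoint (k : Fin 2) (p : ℝ × ℝ) (s : ℝ) : ℝ × ℝ := ![(s, p.2), (p.1, s)] k

theorem linePoint_mem_paramLine {k : Fin 2} {p : ℝ × ℝ} {s : ℝ} {S : Set (ℝ × ℝ)}
    (h : linePoint k p s ∈ S) : linePoint k p s ∈ paramLine k S p := by
  refine ⟨h, ?_⟩
  fin_cases k <;> simp [linePoint]

theorem hasDerivAt_linePoint {k : Fin 2} {p : ℝ × ℝ} {s : ℝ} {G : ℝ × ℝ → Vec}
    (hG : DifferentiableAt ℝ G (linePoint k p s)) :
    HasDerivAt (fun t => G (linePoint k p t)) (pd k G (linePoint k p s)) s := by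
  have h1 : HasDerivAt (linePoint k p) (![((1 : ℝ), (0 : ℝ)), ((0 : ℝ), (1 : ℝ))] k) s := by
    fin_cases k
    · exact (hasDerivAt_id s).prodMk (hasDerivAt_const s p.2)
    · exact (hasDerivAt_const s p.1).prodMk (hasDerivAt_id s)
  exact hG.hasFDerivAt.comp_hasDerivAt s h1

theorem tangentPlane_eq (F : ℝ × ℝ → Vec) (k : Fin 2) (q : ℝ × ℝ) :
    tangentPlane F q = Submodule.span ℝ {F q, pd k F q, pd (1 - k) F q} := by
  fin_cases k
  · rfl
  · simp [tangentPlane, Set.pair_comm]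

namespace IsCharacteristicParametrization

variable {U : Set (ℝ × ℝ)} {f : ℝ × ℝ → RP3} {F : ℝ × ℝ → Vec}

theorem contDiffAt (h : IsCharacteristicParametrization U f F) {q : ℝ × ℝ} (hq : q ∈ U) :
    ContDiffAt ℝ 2 F q :=
  h.contDiffOn.contDiffAt (h.isOpen.mem_nhds hq)

theorem differentiableAt (h : IsCharacteristicParametrization U f F) {q : ℝ × ℝ} (hq : q ∈ U) :
    DifferentiableAt ℝ F q :=
  (h.contDiffAt hq).differentiableAt (by norm_num)

theorem differentiableAt_fderiv (h : IsCharacteristicParametrization U f F) {q : ℝ × ℝ}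
    (hq : q ∈ U) : DifferentiableAt ℝ (fderiv ℝ F) q :=
  ((h.contDiffAt hq).fderiv_right (m := 1) (by norm_num)).differentiableAt (by norm_num)

theorem differentiableAt_pd (h : IsCharacteristicParametrization U f F) {q : ℝ × ℝ} (hq : q ∈ U)
    (k : Fin 2) : DifferentiableAt ℝ (pd k F) q :=
  (h.differentiableAt_fderiv hq).clm_apply (differentiableAt_const _)

theorem pd_pd (h : IsCharacteristicParametrization U f F) {q : ℝ × ℝ} (hq : q ∈ U) (k l : Fin 2) :
    pd k (pd l F) q = fderiv ℝ (fderiv ℝ F) q (![((1 : ℝ), (0 : ℝ)), ((0 : ℝ), (1 : ℝ))] k)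
      (![((1 : ℝ), (0 : ℝ)), ((0 : ℝ), (1 : ℝ))] l) := by
  have := (h.differentiableAt_fderiv hq).hasFDerivAt.clm_apply
    (hasFDerivAt_const (![((1 : ℝ), (0 : ℝ)), ((0 : ℝ), (1 : ℝ))] l) q)
  have h2 : fderiv ℝ (pd l F) q = _ := this.fderiv
  rw [pd, h2]
  simp

theorem pd_comm (h : IsCharacteristicParametrization U f F) {q : ℝ × ℝ} (hq : q ∈ U)
    (k l : Fin 2) : pd k (pd l F) q = pd l (pd k F) q := by
  rw [h.pd_pd hq, h.pd_pd hq]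
  exact (h.contDiffAt hq).isSymmSndFDerivAt (by simp) _ _

theorem pd_pd_mem_tangentPlane (h : IsCharacteristicParametrization U f F) {q : ℝ × ℝ}
    (hq : q ∈ U) (k : Fin 2) : pd k (pd (1 - k) F) q ∈ tangentPlane F q := by
  fin_cases k
  · exact h.conjugate q hq
  · rw [h.pd_comm hq]
    exact h.conjugate q hq

theorem ne_zero (h : IsCharacteristicParametrization U f F) {q : ℝ × ℝ} (hq : q ∈ U) : F q ≠ 0 :=
  (h.lift q hq).1

theorem linearIndependent_tangent (h : IsCharacteristicParametrization U f F) {q : ℝ × ℝ}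
    (hq : q ∈ U) (k : Fin 2) : LinearIndependent ℝ ![F q, pd k F q] := by
  rw [LinearIndependent.pair_iff]
  intro s t hst
  have h1 := Fintype.linearIndependent_iff.1 (h.regular q hq)
  fin_cases k
  · have h2 := h1 ![s, t, 0] (by simpa [Fin.sum_univ_three] using hst)
    exact ⟨h2 0, h2 1⟩
  · have h2 := h1 ![s, 0, t] (by simpa [Fin.sum_univ_three] using hst)
    exact ⟨h2 0, h2 2⟩

theorem finrank_tangentLine (h : IsCharacteristicParametrization U f F) {q : ℝ × ℝ}
    (hq : q ∈ U) (k : Fin 2) : finrank ℝ (tangentLine F k q) = 2 :=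
  finrank_span_pair_of_linearIndependent (h.linearIndependent_tangent hq k)

theorem finrank_tangentPlane (h : IsCharacteristicParametrization U f F) {q : ℝ × ℝ}
    (hq : q ∈ U) : finrank ℝ (tangentPlane F q) = 3 := by
  have := finrank_span_eq_card (h.regular q hq)
  have e : Set.range ![F q, pd 0 F q, pd 1 F q] = {F q, pd 0 F q, pd 1 F q} := by
    ext w; simp [Matrix.range_cons, Matrix.range_empty]; tauto
  rw [e, Fintype.card_fin] at this
  exact this

end IsCharacteristicParametrization

/-! ### The conics of a patch and their cone vertices. -/

namespace SCPatch

variable (P : SCPatch)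

/-- Lower end of the parameter interval of direction `k`. -/
noncomputable def lower (k : Fin 2) : ℝ := ![P.a₀, P.b₀] k

/-- Upper end of the parameter interval of direction `k`. -/
noncomputable def upper (k : Fin 2) : ℝ := ![P.a₁, P.b₁] k

variable {P}

theorem lower_lt_upper (k : Fin 2) : P.lower k < P.upper k := by
  fin_cases k
  · exact P.a_lt
  · exact P.b_lt

theorem mem_U {q : ℝ × ℝ} (hq : q ∈ P.rect) : q ∈ P.U := P.rect_subset hq

theorem linePoint_mem_rect {k : Fin 2} {p : ℝ × ℝ} (hp : p ∈ P.rect) {s : ℝ}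
    (hs : s ∈ Icc (P.lower k) (P.upper k)) : linePoint k p s ∈ P.rect := by
  fin_cases k
  · exact ⟨hs, hp.2⟩
  · exact ⟨hp.1, hs⟩

theorem paramLine_rect {k : Fin 2} {p : ℝ × ℝ} (hp : p ∈ P.rect) :
    paramLine k P.rect p = linePoint k p '' Icc (P.lower k) (P.upper k) := by
  ext q
  constructor
  · rintro ⟨hq, h⟩
    fin_cases k
    · refine ⟨q.1, hq.1, Prod.ext rfl ?_⟩
      exact h.symm
    · refine ⟨q.2, hq.2, Prod.ext ?_ rfl⟩
      exact h.symm
  · rintro ⟨s, hs, rfl⟩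
    exact linePoint_mem_paramLine (linePoint_mem_rect hp hs)

/-- Identifies `supportingPlane`, a span over the closed rectangle only, with the plane W of the
conic given on all of U, since the arc already spans W. -/
theorem exists_isConicArc {k : Fin 2} {p : ℝ × ℝ} (hp : p ∈ P.rect) :
    ∃ B : Vec →ₗ[ℝ] Vec →ₗ[ℝ] ℝ, IsConicArc (P.lower k) (P.upper k)
      (fun s => P.F (linePoint k p s)) (fun s => pd k P.F (linePoint k p s))
      (P.supportingPlane k p) B := by
  have hch := P.characteristic
  obtain ⟨C, ⟨-, W, Q, hW, hnd, hC⟩, hf⟩ := hch.conics p (mem_U hp) k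
  have hmem : ∀ s ∈ Icc (P.lower k) (P.upper k), linePoint k p s ∈ P.U :=
    fun s hs => mem_U (linePoint_mem_rect hp hs)
  have hfC : ∀ s ∈ Icc (P.lower k) (P.upper k),
      P.F (linePoint k p s) ∈ W ∧ Q (P.F (linePoint k p s)) = 0 := by
    intro s hs
    obtain ⟨h0, h1⟩ := hch.lift _ (hmem s hs)
    have h2 := hf _ (linePoint_mem_paramLine (hmem s hs))
    rw [hC] at h2
    exact ⟨(mem_of_submodule_mk_le h0 h1).1 h2.1, quadraticForm_rep_eq_zero h0 h1 Q h2.2⟩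
  have harc : IsConicArc (P.lower k) (P.upper k) (fun s => P.F (linePoint k p s))
      (fun s => pd k P.F (linePoint k p s)) W Q.polarBilin :=
    { lt := lower_lt_upper k
      deriv := fun s hs =>
        (hasDerivAt_linePoint (hch.differentiableAt (hmem s hs))).hasDerivWithinAt
      indep := fun s hs => hch.linearIndependent_tangent (hmem s hs) k
      finrank_eq := hW
      symm := fun x y => QuadraticMap.polar_comm Q x y
      nondeg := hnd
      mem := fun s hs => (hfC s hs).1
      isotropic := fun s hs => by
        rw [QuadraticMap.polarBilin_apply_apply, QuadraticMap.polar_self, (hfC s hs).2, smul_zero] }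
  refine ⟨Q.polarBilin, ?_⟩
  have : P.supportingPlane k p = W := by
    rw [supportingPlane, paramLine_rect hp, ← harc.span_image_eq, image_image]
  rw [this]
  exact harc

theorem exists_coneVertex {k : Fin 2} {p : ℝ × ℝ} (hp : p ∈ P.rect) :
    ∃ c : Vec, c ≠ 0 ∧ P.coneVertex k p = Submodule.span ℝ {c} ∧ c ∉ P.supportingPlane k p ∧
      ∀ q ∈ paramLine k P.rect p, c ∈ tangentLine P.F (1 - k) q := by
  have hch := P.characteristic
  obtain ⟨B, harc⟩ := exists_isConicArc (k := k) hp
  obtain ⟨Q, hrk, hQ⟩ := hch.cones p (mem_U hp) k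
  have hmem : ∀ s ∈ Icc (P.lower k) (P.upper k), linePoint k p s ∈ P.U :=
    fun s hs => mem_U (linePoint_mem_rect hp hs)
  obtain ⟨c, hc, hspan⟩ := finrank_eq_one_iff'.1 hrk
  have hc0 : (c : Vec) ≠ 0 := fun h => hc (Subtype.ext h)
  have hker : LinearMap.ker Q.polarBilin = Submodule.span ℝ {(c : Vec)} := by
    apply le_antisymm
    · intro w hw
      obtain ⟨a, ha⟩ := hspan ⟨w, hw⟩
      exact Submodule.mem_span_singleton.2 ⟨a, congrArg Subtype.val ha⟩
    · rw [Submodule.span_singleton_le_iff_mem]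
      exact c.2
  have hT : ∀ s ∈ Icc (P.lower k) (P.upper k), tangentPlane P.F (linePoint k p s) =
      LinearMap.ker (Q.polarBilin (P.F (linePoint k p s))) :=
    fun s hs => (hQ _ (linePoint_mem_paramLine (hmem s hs))).2
  have hsymm : ∀ x y, Q.polarBilin x y = Q.polarBilin y x := fun x y => QuadraticMap.polar_comm Q x y
  -- The curve avoids the vertex of the cone: a polar plane there would be the whole space, while
  -- the tangent plane has dimension 3.
  have hne : ∀ s ∈ Icc (P.lower k) (P.upper k), Q.polarBilin (P.F (linePoint k p s)) ≠ 0 := by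
    intro s hs h0
    have h1 := hT s hs
    have h2 := hch.finrank_tangentPlane (hmem s hs)
    rw [h1, h0, LinearMap.ker_zero, finrank_top, finrank_vec] at h2
    omega
  have hiso : ∀ s ∈ Icc (P.lower k) (P.upper k),
      Q.polarBilin (P.F (linePoint k p s)) (P.F (linePoint k p s)) = 0 := by
    intro s hs
    rw [QuadraticMap.polarBilin_apply_apply, QuadraticMap.polar_self,
      (hQ _ (linePoint_mem_paramLine (hmem s hs))).1, smul_zero]
  have hcW := harc.coneVertex_notMem finrank_vec hsymm hker hc0 hiso hne
  refine ⟨c, hc0, ?_, hcW, ?_⟩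
  · rw [coneVertex, paramLine_rect hp, iInf_image]
    apply le_antisymm
    · intro x hx
      simp only [Submodule.mem_iInf] at hx
      refine harc.mem_span_coneVertex finrank_vec hsymm hker hcW fun s hs => ?_
      have := hx s hs
      rwa [hT s hs] at this
    · rw [Submodule.span_singleton_le_iff_mem]
      simp only [Submodule.mem_iInf]
      intro s hs
      have : Q.polarBilin (c : Vec) = 0 := c.2
      rw [hT s hs, LinearMap.mem_ker, hsymm, this]
      rfl
  · rw [paramLine_rect hp]
    rintro _ ⟨s, hs, rfl⟩
    refine harc.coneVertex_mem_conjugate finrank_vec hsymm hker hc0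
      (η := fun s => pd (1 - k) P.F (linePoint k p s))
      (η' := fun s => pd k (pd (1 - k) P.F) (linePoint k p s)) ?_ ?_ ?_ hne s hs
    · exact fun t ht =>
        (hasDerivAt_linePoint (hch.differentiableAt_pd (hmem t ht) _)).hasDerivWithinAt
    · intro t ht
      rw [← tangentPlane_eq]
      exact hch.pd_pd_mem_tangentPlane (hmem t ht) k
    · intro t ht
      rw [← tangentPlane_eq]
      exact hT t ht

end SCPatch

/-! ### The characteristic lines, the projections along them, and their position relative to the
patch. -/

theorem paramLine_eq_of_mem {k : Fin 2} {S : Set (ℝ × ℝ)} {p q : ℝ × ℝ}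
    (hq : q ∈ paramLine k S p) : paramLine k S q = paramLine k S p := by
  ext x
  simp only [paramLine, mem_ofPred_eq, hq.2]

namespace SCPatch

variable {P : SCPatch}

theorem supportingPlane_eq_of_mem {k : Fin 2} {p q : ℝ × ℝ} (hq : q ∈ paramLine k P.rect p) :
    P.supportingPlane k q = P.supportingPlane k p := by
  rw [supportingPlane, supportingPlane, paramLine_eq_of_mem hq]

theorem exists_mem_paramLine_inter (k : Fin 2) {p q : ℝ × ℝ} (hp : p ∈ P.rect) (hq : q ∈ P.rect) :
    ∃ x ∈ paramLine k P.rect p, x ∈ paramLine (1 - k) P.rect q := by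
  fin_cases k
  · exact ⟨(q.1, p.2), ⟨⟨hq.1, hp.2⟩, rfl⟩, ⟨⟨hq.1, hp.2⟩, rfl⟩⟩
  · exact ⟨(p.1, q.2), ⟨⟨hp.1, hq.2⟩, rfl⟩, ⟨⟨hp.1, hq.2⟩, rfl⟩⟩

theorem exists_linePoint_eq (k : Fin 2) {p : ℝ × ℝ} (hp : p ∈ P.rect) :
    ∃ s ∈ Icc (P.lower k) (P.upper k), linePoint k p s = p ∧
      ∀ q ∈ paramLine (1 - k) P.rect p, linePoint k q s = q := by
  fin_cases k
  · exact ⟨p.1, hp.1, rfl, fun q hq => Prod.ext hq.2.symm rfl⟩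
  · exact ⟨p.2, hp.2, rfl, fun q hq => Prod.ext rfl hq.2.symm⟩

theorem linePoint_mem_conjugate {k : Fin 2} {p q : ℝ × ℝ} (hq : q ∈ paramLine k P.rect p)
    {s : ℝ} (hs : s ∈ Icc (P.lower (1 - k)) (P.upper (1 - k))) :
    linePoint (1 - k) q s ∈ paramLine k P.rect (linePoint (1 - k) p s) := by
  refine ⟨linePoint_mem_rect hq.1 hs, ?_⟩
  fin_cases k <;> rfl

theorem finrank_supportingPlane (k : Fin 2) {p : ℝ × ℝ} (hp : p ∈ P.rect) :
    finrank ℝ (P.supportingPlane k p) = 3 :=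
  (exists_isConicArc hp).choose_spec.finrank_eq

theorem mem_supportingPlane (k : Fin 2) {p : ℝ × ℝ} (hp : p ∈ P.rect) :
    P.F p ∈ P.supportingPlane k p :=
  Submodule.subset_span ⟨p, ⟨hp, rfl⟩, rfl⟩

theorem tangentLine_le_supportingPlane (k : Fin 2) {p : ℝ × ℝ} (hp : p ∈ P.rect) :
    tangentLine P.F k p ≤ P.supportingPlane k p := by
  obtain ⟨B, h⟩ := exists_isConicArc (k := k) hp
  obtain ⟨s, hs, hsp, -⟩ := exists_linePoint_eq k hp
  have h1 := h.deriv_mem hs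
  simp only [hsp] at h1
  rw [tangentLine, Submodule.span_le]
  rintro _ (rfl | rfl)
  · exact mem_supportingPlane k hp
  · exact h1

theorem characteristicLine_le {k : Fin 2} {p : ℝ × ℝ} (hp : p ∈ P.rect) :
    P.characteristicLine k ≤ P.supportingPlane k p :=
  iInf₂_le p hp

/-- The cone vertices of each family lie on the characteristic line of the other family. -/
theorem mem_characteristicLine {k : Fin 2} {p : ℝ × ℝ} (hp : p ∈ P.rect) {c : Vec}
    (hc : ∀ q ∈ paramLine k P.rect p, c ∈ tangentLine P.F (1 - k) q) :
    c ∈ P.characteristicLine (1 - k) := by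
  simp only [characteristicLine, Submodule.mem_iInf]
  intro q hq
  -- The conic of the other family through q crosses the given conic at x, and its tangent at x
  -- passes through c.
  obtain ⟨x, hx, hxq⟩ := exists_mem_paramLine_inter k hp hq
  rw [← supportingPlane_eq_of_mem hxq]
  exact tangentLine_le_supportingPlane _ hx.1 (hc x hx)

/-- Two distinct cone vertices on the axis suffice. All cone vertices met along one conic of family
1 - k lie on its tangents, which are not concurrent. -/
theorem two_le_finrank_characteristicLine (k : Fin 2) :
    2 ≤ finrank ℝ (P.characteristicLine (1 - k)) := by
  have hp : P.corner 0 0 ∈ P.rect :=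
    ⟨left_mem_Icc.2 P.a_lt.le, left_mem_Icc.2 P.b_lt.le⟩
  obtain ⟨c, hc0, hcv, -, hc⟩ := exists_coneVertex (k := k) hp
  obtain ⟨B, harc⟩ := exists_isConicArc (k := 1 - k) hp
  have hself : P.corner 0 0 ∈ paramLine k P.rect (P.corner 0 0) := ⟨hp, rfl⟩
  have hcW : c ∈ P.supportingPlane (1 - k) (P.corner 0 0) :=
    tangentLine_le_supportingPlane _ hp (hc _ hself)
  obtain ⟨s, hs, hcs⟩ : ∃ s ∈ Icc (P.lower (1 - k)) (P.upper (1 - k)),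
      c ∉ tangentLine P.F (1 - k) (linePoint (1 - k) (P.corner 0 0) s) := by
    by_contra! hcon
    exact hc0 (harc.eq_zero_of_mem_tangent hcW hcon)
  have hq := linePoint_mem_rect (k := 1 - k) hp hs
  obtain ⟨c', hc0', -, -, hc'⟩ := exists_coneVertex (k := k) hq
  have hli : LinearIndependent ℝ ![c', c] := by
    apply linearIndependent_pair_of_notMem hc0'
    intro hm
    apply hcs
    obtain ⟨a, rfl⟩ := Submodule.mem_span_singleton.1 hm
    exact Submodule.smul_mem _ _ (hc' _ ⟨hq, rfl⟩)
  refine (finrank_span_pair_of_linearIndependent hli).ge.trans (Submodule.finrank_mono ?_)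
  rw [Submodule.span_le]
  rintro _ (rfl | rfl)
  · exact mem_characteristicLine hq hc'
  · exact mem_characteristicLine hp hc

theorem finrank_characteristicLine (hskew : P.SkewCharacteristicLines) (k : Fin 2) :
    finrank ℝ (P.characteristicLine k) = 2 := by
  have h1 : 2 ≤ finrank ℝ (P.characteristicLine 1) := two_le_finrank_characteristicLine 0
  have h2 : 2 ≤ finrank ℝ (P.characteristicLine 0) := two_le_finrank_characteristicLine 1
  have h3 := Submodule.finrank_sup_add_finrank_inf_eq (P.characteristicLine 0)
    (P.characteristicLine 1)
  have h4 := Submodule.finrank_le (P.characteristicLine 0 ⊔ P.characteristicLine 1)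
  rw [SkewCharacteristicLines] at hskew
  rw [hskew, finrank_bot] at h3
  rw [finrank_vec] at h4
  fin_cases k
  · change finrank ℝ (P.characteristicLine 0) = 2
    omega
  · change finrank ℝ (P.characteristicLine 1) = 2
    omega

theorem isCompl_characteristicLine (hskew : P.SkewCharacteristicLines) (k : Fin 2) :
    IsCompl (P.characteristicLine (1 - k)) (P.characteristicLine k) := by
  have h3 := Submodule.finrank_sup_add_finrank_inf_eq (P.characteristicLine 0)
    (P.characteristicLine 1)
  rw [SkewCharacteristicLines] at hskew
  rw [hskew, finrank_bot, finrank_characteristicLine hskew, finrank_characteristicLine hskew] at h3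
  have h : IsCompl (P.characteristicLine 0) (P.characteristicLine 1) :=
    ⟨disjoint_iff.2 hskew, codisjoint_iff.2 (Submodule.eq_top_of_finrank_eq (by
      rw [finrank_vec]; omega))⟩
  fin_cases k
  · exact h.symm
  · exact h

theorem tangentLine_eq_span {k : Fin 2} {p : ℝ × ℝ} (hp : p ∈ P.rect) {c : Vec} (hc0 : c ≠ 0)
    (hcW : c ∉ P.supportingPlane k p) (hc : c ∈ tangentLine P.F (1 - k) p) :
    tangentLine P.F (1 - k) p = Submodule.span ℝ {P.F p, c} := by
  refine (span_pair_eq_of_linearIndependent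
    (P.characteristic.finrank_tangentLine (mem_U hp) _) ?_ (Submodule.subset_span (by simp)) hc).symm
  apply linearIndependent_pair_of_notMem (P.characteristic.ne_zero (mem_U hp))
  intro h
  apply hcW
  rw [Submodule.mem_span_singleton] at h
  obtain ⟨a, rfl⟩ := h
  exact Submodule.smul_mem _ _ (mem_supportingPlane k hp)

/-- Projection to the characteristic line of the family other than `k`, from the characteristic
line of the family `k`. -/
noncomputable def axisProj (hskew : P.SkewCharacteristicLines) (k : Fin 2) : Vec →ₗ[ℝ] Vec :=
  (P.characteristicLine (1 - k)).projection (P.characteristicLine k)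
    (isCompl_characteristicLine hskew k)

theorem axisProj_mem (hskew : P.SkewCharacteristicLines) (k : Fin 2) (x : Vec) :
    axisProj hskew k x ∈ P.characteristicLine (1 - k) :=
  Submodule.projection_apply_mem _ _

theorem axisProj_eq_self (hskew : P.SkewCharacteristicLines) {k : Fin 2} {x : Vec}
    (hx : x ∈ P.characteristicLine (1 - k)) : axisProj hskew k x = x :=
  (Submodule.projection_eq_self_iff _ _).2 hx

theorem axisProj_eq_zero (hskew : P.SkewCharacteristicLines) {k : Fin 2} {x : Vec} :
    axisProj hskew k x = 0 ↔ x ∈ P.characteristicLine k :=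
  Submodule.projection_apply_eq_zero_iff _

theorem sub_axisProj_mem (hskew : P.SkewCharacteristicLines) (k : Fin 2) (x : Vec) :
    x - axisProj hskew k x ∈ P.characteristicLine k :=
  Submodule.sub_projection_mem _ _

theorem axisProj_mem_supportingPlane (hskew : P.SkewCharacteristicLines) {k : Fin 2} {p : ℝ × ℝ}
    (hp : p ∈ P.rect) {x : Vec} (hx : x ∈ P.supportingPlane k p) :
    axisProj hskew k x ∈ P.supportingPlane k p := by
  rw [← sub_sub_cancel x (axisProj hskew k x)]
  exact Submodule.sub_mem _ hx (characteristicLine_le hp (sub_axisProj_mem hskew k x))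

/-- The plane of a conic of family k contains the centre of projection, so its image is its
intersection with the other axis. This is at most a point, because the cone vertex lies on that axis
but not in the plane. -/
theorem exists_axisProj_mem_span (hskew : P.SkewCharacteristicLines) {k : Fin 2} {p : ℝ × ℝ}
    (hp : p ∈ P.rect) :
    ∃ e, ∀ x ∈ P.supportingPlane k p, axisProj hskew k x ∈ Submodule.span ℝ {e} := by
  obtain ⟨d, hd0, -, hdM, hd⟩ := exists_coneVertex (k := k) hp
  have hdX := mem_characteristicLine hp hd
  have hlt : P.supportingPlane k p ⊓ P.characteristicLine (1 - k) < P.characteristicLine (1 - k) :=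
    lt_of_le_of_ne inf_le_right fun h => hdM ((h.ge hdX).1)
  have h1 := Submodule.finrank_lt_finrank_of_lt hlt
  rw [finrank_characteristicLine hskew] at h1
  obtain ⟨e, he⟩ := finrank_le_one_iff.1 (Nat.lt_succ_iff.1 h1)
  refine ⟨e, fun x hx => ?_⟩
  obtain ⟨a, ha⟩ := he ⟨_, axisProj_mem_supportingPlane hskew hp hx, axisProj_mem hskew k x⟩
  exact Submodule.mem_span_singleton.2 ⟨a, congrArg Subtype.val ha⟩

theorem hasDerivWithinAt_axisProj (hskew : P.SkewCharacteristicLines) (k l : Fin 2) {p : ℝ × ℝ}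
    (hp : p ∈ P.rect) {s : ℝ} (hs : s ∈ Icc (P.lower l) (P.upper l)) :
    HasDerivWithinAt (fun t => axisProj hskew k (P.F (linePoint l p t)))
      (axisProj hskew k (pd l P.F (linePoint l p s))) (Icc (P.lower l) (P.upper l)) s :=
  (axisProj hskew k).toContinuousLinearMap.hasFDerivAt.comp_hasDerivWithinAt s
    (hasDerivAt_linePoint (P.characteristic.differentiableAt
      (mem_U (linePoint_mem_rect hp hs)))).hasDerivWithinAt

/-- A generic patch does not meet its characteristic lines. -/
theorem notMem_characteristicLine (hskew : P.SkewCharacteristicLines) (k : Fin 2) {p : ℝ × ℝ}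
    (hp : p ∈ P.rect) : P.F p ∉ P.characteristicLine k := by
  intro hF
  obtain ⟨d, hd0, -, hdM, hd⟩ := exists_coneVertex (k := k) hp
  have hdX := mem_characteristicLine hp hd
  -- A second point of the same conic, off the axis. Moved together in the conjugate direction, the
  -- two points stay on a common conic, so their projections remain proportional.
  obtain ⟨p₁, hp₁, hF₁⟩ : ∃ q ∈ paramLine k P.rect p, P.F q ∉ P.characteristicLine k := by
    by_contra! hc
    have hle : P.supportingPlane k p ≤ P.characteristicLine k :=
      Submodule.span_le.2 (by rintro _ ⟨q, hq, rfl⟩; exact hc q hq)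
    have := Submodule.finrank_mono hle
    rw [finrank_supportingPlane k hp, finrank_characteristicLine hskew] at this
    omega
  obtain ⟨s, hs, hsp, hsq⟩ := exists_linePoint_eq (1 - k) hp
  rw [sub_sub_cancel] at hsq
  have hsp₁ := hsq p₁ hp₁
  have hG := hasDerivWithinAt_axisProj hskew k (1 - k) hp hs
  have hH := hasDerivWithinAt_axisProj hskew k (1 - k) hp₁.1 hs
  have hH0 : axisProj hskew k (P.F (linePoint (1 - k) p₁ s)) ≠ 0 := by
    rw [hsp₁]
    exact fun h => hF₁ ((axisProj_eq_zero hskew).1 h)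
  obtain ⟨κ, hκ⟩ := exists_deriv_eq_of_proportional (lower_lt_upper _) hs hG hH (fun t ht => by
    have hr := linePoint_mem_rect (k := 1 - k) hp ht
    obtain ⟨e, he⟩ := exists_axisProj_mem_span hskew (k := k) hr
    refine ⟨e, he _ (mem_supportingPlane k hr), he _ ?_⟩
    rw [← supportingPlane_eq_of_mem (linePoint_mem_conjugate hp₁ ht)]
    -- The ratio is 0 at p, as F p projects to zero; hence the projected velocity at p is a multiple
    -- of the projection of F p₁. That velocity is a nonzero multiple of d, which is thereby forced
    -- into the plane of the conic, a contradiction.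
    exact mem_supportingPlane k (linePoint_mem_rect hp₁.1 ht)) hH0 (ρ := 0) (by
    rw [zero_smul, hsp]
    exact (axisProj_eq_zero hskew).2 hF)
  rw [zero_smul, zero_add, hsp, hsp₁] at hκ
  have hpd : pd (1 - k) P.F p ∈ Submodule.span ℝ {P.F p, d} := by
    rw [← tangentLine_eq_span hp hd0 hdM (hd p ⟨hp, rfl⟩)]
    exact Submodule.subset_span (by simp)
  obtain ⟨x, y, hxy⟩ := Submodule.mem_span_pair.1 hpd
  have hy : y ≠ 0 := by
    rintro rfl
    refine notMem_span_of_linearIndependent_pair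
      (P.characteristic.linearIndependent_tangent (mem_U hp) (1 - k)) ?_
    rw [← hxy, zero_smul, add_zero]
    exact Submodule.smul_mem _ _ (Submodule.mem_span_singleton_self _)
  rw [← hxy, map_add, map_smul, map_smul, (axisProj_eq_zero hskew).2 hF, smul_zero, zero_add,
    axisProj_eq_self hskew hdX] at hκ
  apply hdM
  rw [← Submodule.smul_mem_iff _ hy, hκ]
  apply Submodule.smul_mem
  apply axisProj_mem_supportingPlane hskew hp
  rw [← supportingPlane_eq_of_mem hp₁]
  exact mem_supportingPlane k hp₁.1

end SCPatch

/-! ### The normal form F(u, v) ∼ a(u) + b(v). -/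

namespace SCPatch

variable {P : SCPatch}

/-- A presentation `F(u, v) ∼ a(u) + b(v)` of a patch, with planar curves `a` and `b` in two
complementary planes; `d` and `c` span the vertices of the tangent cones. -/
structure IsTranslational (P : SCPatch) (A B : Submodule ℝ Vec) (a d b c : ℝ → Vec) : Prop where
  isCompl : IsCompl A B
  finrank_left : finrank ℝ A = 2
  finrank_right : finrank ℝ B = 2
  a_mem : ∀ u ∈ Icc P.a₀ P.a₁, a u ∈ A
  d_mem : ∀ u ∈ Icc P.a₀ P.a₁, d u ∈ A
  b_mem : ∀ v ∈ Icc P.b₀ P.b₁, b v ∈ B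
  c_mem : ∀ v ∈ Icc P.b₀ P.b₁, c v ∈ B
  indep_left : ∀ u ∈ Icc P.a₀ P.a₁, LinearIndependent ℝ ![a u, d u]
  indep_right : ∀ v ∈ Icc P.b₀ P.b₁, LinearIndependent ℝ ![b v, c v]
  coord : ∀ u ∈ Icc P.a₀ P.a₁, ∀ v ∈ Icc P.b₀ P.b₁, ∃ μ : ℝ, μ ≠ 0 ∧ P.F (u, v) = μ • (a u + b v)
  tangent_left : ∀ u ∈ Icc P.a₀ P.a₁, ∀ v ∈ Icc P.b₀ P.b₁,
    tangentLine P.F 0 (u, v) = Submodule.span ℝ {a u + b v, d u}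
  tangent_right : ∀ u ∈ Icc P.a₀ P.a₁, ∀ v ∈ Icc P.b₀ P.b₁,
    tangentLine P.F 1 (u, v) = Submodule.span ℝ {a u + b v, c v}
  plane_left : ∀ u ∈ Icc P.a₀ P.a₁, ∀ v ∈ Icc P.b₀ P.b₁,
    P.supportingPlane 0 (u, v) = A ⊔ Submodule.span ℝ {b v}
  plane_right : ∀ u ∈ Icc P.a₀ P.a₁, ∀ v ∈ Icc P.b₀ P.b₁,
    P.supportingPlane 1 (u, v) = B ⊔ Submodule.span ℝ {a u}
  vertex_left : ∀ u ∈ Icc P.a₀ P.a₁, ∀ v ∈ Icc P.b₀ P.b₁,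
    P.coneVertex 0 (u, v) = Submodule.span ℝ {c v}
  vertex_right : ∀ u ∈ Icc P.a₀ P.a₁, ∀ v ∈ Icc P.b₀ P.b₁,
    P.coneVertex 1 (u, v) = Submodule.span ℝ {d u}
  eq_left : ∀ u ∈ Icc P.a₀ P.a₁, ∀ u' ∈ Icc P.a₀ P.a₁,
    a u' - a u ∈ Submodule.span ℝ {d u} → a u' = a u
  eq_right : ∀ v ∈ Icc P.b₀ P.b₁, ∀ v' ∈ Icc P.b₀ P.b₁,
    b v' - b v ∈ Submodule.span ℝ {c v} → b v' = b v

/-- Along each conic of the first family, the surface is the translate of a curve in the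
characteristic line with velocity towards the vertices of the conjugate cones. -/
theorem exists_curve_add_const (hskew : P.SkewCharacteristicLines) {d : ℝ → Vec}
    (hdX : ∀ u ∈ Icc P.a₀ P.a₁, d u ∈ P.characteristicLine 0)
    (hd : ∀ u ∈ Icc P.a₀ P.a₁, ∀ v ∈ Icc P.b₀ P.b₁,
      tangentLine P.F 0 (u, v) = Submodule.span ℝ {P.F (u, v), d u})
    {v : ℝ} (hv : v ∈ Icc P.b₀ P.b₁) :
    ∃ (G G' : ℝ → Vec) (σ : ℝ → ℝ), ∃ b ∈ P.characteristicLine 1, ∀ u ∈ Icc P.a₀ P.a₁,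
      P.F (u, v) = σ u • (G u + b) ∧ σ u ≠ 0 ∧ G u ∈ P.characteristicLine 0 ∧
      HasDerivWithinAt G (G' u) (Icc P.a₀ P.a₁) u ∧ G' u ∈ Submodule.span ℝ {d u} := by
  have hmem : ∀ u ∈ Icc P.a₀ P.a₁, (u, v) ∈ P.rect := fun u hu => ⟨hu, hv⟩
  have hp : (P.a₀, v) ∈ P.rect := hmem _ (left_mem_Icc.2 P.a_lt.le)
  have hline : ∀ u ∈ Icc P.a₀ P.a₁, (u, v) ∈ paramLine 0 P.rect (P.a₀, v) :=
    fun u hu => ⟨hmem u hu, rfl⟩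
  obtain ⟨e, he⟩ := exists_axisProj_mem_span hskew (k := 0) hp
  have hβ : ∀ u ∈ Icc P.a₀ P.a₁, axisProj hskew 0 (P.F (u, v)) ∈ Submodule.span ℝ {e} :=
    fun u hu => he _ (Submodule.subset_span ⟨_, hline u hu, rfl⟩)
  have hβ0 : ∀ u ∈ Icc P.a₀ P.a₁, axisProj hskew 0 (P.F (u, v)) ≠ 0 := fun u hu h =>
    notMem_characteristicLine hskew 0 (hmem u hu) ((axisProj_eq_zero hskew).1 h)
  choose! σ hσ using fun u hu => Submodule.mem_span_singleton.1 (hβ u hu)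
  have hσ0 : ∀ u ∈ Icc P.a₀ P.a₁, σ u ≠ 0 := by
    intro u hu h
    apply hβ0 u hu
    rw [← hσ u hu, h, zero_smul]
  have ha₀ := left_mem_Icc.2 P.a_lt.le
  have he0 : e ≠ 0 := by
    rintro rfl
    exact hβ0 _ ha₀ (by rw [← hσ _ ha₀, smul_zero])
  have heX : e ∈ P.characteristicLine 1 := by
    rw [← Submodule.smul_mem_iff _ (hσ0 _ ha₀), hσ _ ha₀]
    exact axisProj_mem hskew 0 _
  obtain ⟨m, hm⟩ : ∃ m : Vec →ₗ[ℝ] ℝ, m e ≠ 0 := by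
    by_contra! hc
    exact he0 ((Module.forall_dual_apply_eq_zero_iff ℝ e).1 hc)
  set M := m.toContinuousLinearMap
  have hme : M e ≠ 0 := hm
  have hMσ : ∀ u ∈ Icc P.a₀ P.a₁, M (axisProj hskew 0 (P.F (u, v))) = σ u * M e := by
    intro u hu
    rw [← hσ u hu, map_smul, smul_eq_mul]
  have hvel : ∀ u ∈ Icc P.a₀ P.a₁, ∃ x y : ℝ, x • P.F (u, v) + y • d u = pd 0 P.F (u, v) := by
    intro u hu
    rw [← Submodule.mem_span_pair, ← hd u hu v hv]
    exact Submodule.subset_span (by simp)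
  choose! x y hxy using hvel
  -- Here F is divided by M of its component in the second axis, which is σ u * M e. That component
  -- becomes the constant e / M e, and the other one becomes G.
  refine ⟨fun u => (M (axisProj hskew 0 (P.F (u, v))))⁻¹ • axisProj hskew 1 (P.F (u, v)),
    fun u => (σ u * M e)⁻¹ • y u • d u, fun u => σ u * M e, (M e)⁻¹ • e,
    Submodule.smul_mem _ _ heX, fun u hu => ⟨?_, mul_ne_zero (hσ0 u hu) hme, ?_, ?_, ?_⟩⟩
  · have h1 : P.F (u, v) = axisProj hskew 1 (P.F (u, v)) + axisProj hskew 0 (P.F (u, v)) :=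
      (Submodule.projection_add_projection_eq_self (isCompl_characteristicLine hskew 1) _).symm
    simp only
    rw [hMσ u hu, smul_add, smul_inv_smul₀ (mul_ne_zero (hσ0 u hu) hme), smul_smul,
      mul_inv_cancel_right₀ hme, hσ u hu]
    exact h1
  · exact Submodule.smul_mem _ _ (axisProj_mem hskew 1 _)
  · have h0 : HasDerivWithinAt (fun t => M (axisProj hskew 0 (P.F (t, v))))
        (M (axisProj hskew 0 (pd 0 P.F (u, v)))) (Icc P.a₀ P.a₁) u :=
      M.hasFDerivAt.comp_hasDerivWithinAt u (hasDerivWithinAt_axisProj hskew 0 0 hp hu)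
    have h1 : HasDerivWithinAt (fun t => axisProj hskew 1 (P.F (t, v)))
        (axisProj hskew 1 (pd 0 P.F (u, v))) (Icc P.a₀ P.a₁) u :=
      hasDerivWithinAt_axisProj hskew 1 0 hp hu
    have hne : M (axisProj hskew 0 (P.F (u, v))) ≠ 0 := by
      rw [hMσ u hu]; exact mul_ne_zero (hσ0 u hu) hme
    have h2 := (h0.inv hne).smul h1
    have hd0 : axisProj hskew 0 (d u) = 0 := (axisProj_eq_zero hskew (k := 0)).2 (hdX u hu)
    have hd1 : axisProj hskew 1 (d u) = d u := axisProj_eq_self hskew (k := 1) (hdX u hu)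
    -- With ∂F = x F + y d, the quotient rule cancels the x-terms, since d has no component in the
    -- second axis.
    refine h2.congr_deriv ?_
    simp only [Pi.inv_apply]
    rw [← hxy u hu, map_add, map_add, map_smul, map_smul, map_smul, map_smul, hd0, hd1, smul_zero,
      add_zero, map_smul, ← hMσ u hu, smul_eq_mul, smul_add, add_comm, ← add_assoc]
    convert zero_add _ using 2
    rw [smul_smul, ← add_smul]
    convert zero_smul ℝ _ using 2
    field_simp
    ring
  · exact Submodule.smul_mem _ _ (Submodule.smul_mem _ _ (Submodule.mem_span_singleton_self _))

/-- For each v the preceding lemma gives a curve G v in the first axis and a constant β v in the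
second. The G v differ only by constant factors R v, so one curve serves all v. -/
theorem exists_coord (hskew : P.SkewCharacteristicLines) :
    ∃ a d b c : ℝ → Vec, P.IsTranslational (P.characteristicLine 0) (P.characteristicLine 1)
      a d b c := by
  have ha₀ := left_mem_Icc.2 P.a_lt.le
  have hb₀ := left_mem_Icc.2 P.b_lt.le
  have hcone1 : ∀ u ∈ Icc P.a₀ P.a₁, ∃ d : Vec, d ≠ 0 ∧
      P.coneVertex 1 (u, P.b₀) = Submodule.span ℝ {d} ∧ d ∉ P.supportingPlane 1 (u, P.b₀) ∧
      ∀ q ∈ paramLine 1 P.rect (u, P.b₀), d ∈ tangentLine P.F 0 q :=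
    fun u hu => exists_coneVertex (k := 1) ⟨hu, hb₀⟩
  have hcone0 : ∀ v ∈ Icc P.b₀ P.b₁, ∃ c : Vec, c ≠ 0 ∧
      P.coneVertex 0 (P.a₀, v) = Submodule.span ℝ {c} ∧ c ∉ P.supportingPlane 0 (P.a₀, v) ∧
      ∀ q ∈ paramLine 0 P.rect (P.a₀, v), c ∈ tangentLine P.F 1 q :=
    fun v hv => exists_coneVertex (k := 0) ⟨ha₀, hv⟩
  choose! d hd0 hdv hdM hd using hcone1
  choose! c hc0 hcv hcM hc using hcone0
  have hl1 : ∀ u ∈ Icc P.a₀ P.a₁, ∀ v ∈ Icc P.b₀ P.b₁, (u, v) ∈ paramLine 1 P.rect (u, P.b₀) :=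
    fun u hu v hv => ⟨⟨hu, hv⟩, rfl⟩
  have hl0 : ∀ u ∈ Icc P.a₀ P.a₁, ∀ v ∈ Icc P.b₀ P.b₁, (u, v) ∈ paramLine 0 P.rect (P.a₀, v) :=
    fun u hu v hv => ⟨⟨hu, hv⟩, rfl⟩
  have hdX : ∀ u ∈ Icc P.a₀ P.a₁, d u ∈ P.characteristicLine 0 :=
    fun u hu => mem_characteristicLine (k := 1) ⟨hu, hb₀⟩ (hd u hu)
  have hcX : ∀ v ∈ Icc P.b₀ P.b₁, c v ∈ P.characteristicLine 1 :=
    fun v hv => mem_characteristicLine (k := 0) ⟨ha₀, hv⟩ (hc v hv)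
  have hdM' : ∀ u ∈ Icc P.a₀ P.a₁, ∀ v ∈ Icc P.b₀ P.b₁, d u ∉ P.supportingPlane 1 (u, v) := by
    intro u hu v hv
    rw [supportingPlane_eq_of_mem (hl1 u hu v hv)]
    exact hdM u hu
  have hcM' : ∀ u ∈ Icc P.a₀ P.a₁, ∀ v ∈ Icc P.b₀ P.b₁, c v ∉ P.supportingPlane 0 (u, v) := by
    intro u hu v hv
    rw [supportingPlane_eq_of_mem (hl0 u hu v hv)]
    exact hcM v hv
  have ht0 : ∀ u ∈ Icc P.a₀ P.a₁, ∀ v ∈ Icc P.b₀ P.b₁,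
      tangentLine P.F 0 (u, v) = Submodule.span ℝ {P.F (u, v), d u} := fun u hu v hv =>
    tangentLine_eq_span (k := 1) ⟨hu, hv⟩ (hd0 u hu) (hdM' u hu v hv) (hd u hu _ (hl1 u hu v hv))
  have ht1 : ∀ u ∈ Icc P.a₀ P.a₁, ∀ v ∈ Icc P.b₀ P.b₁,
      tangentLine P.F 1 (u, v) = Submodule.span ℝ {P.F (u, v), c v} := fun u hu v hv =>
    tangentLine_eq_span (k := 0) ⟨hu, hv⟩ (hc0 v hv) (hcM' u hu v hv) (hc v hv _ (hl0 u hu v hv))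
  choose! G G' σ β hβX hF hσ0 hGX hG hG' using
    fun v hv => exists_curve_add_const hskew hdX ht0 (v := v) hv
  have hGM : ∀ u ∈ Icc P.a₀ P.a₁, ∀ v ∈ Icc P.b₀ P.b₁, G v u ∈ P.supportingPlane 1 (u, v) := by
    intro u hu v hv
    have hq : (u, v) ∈ P.rect := ⟨hu, hv⟩
    have h1 := mem_supportingPlane 1 hq
    rw [hF v hv u hu, Submodule.smul_mem_iff _ (hσ0 v hv u hu)] at h1
    exact (Submodule.add_mem_iff_left _ (characteristicLine_le hq (hβX v hv))).1 h1
  have hG0 : ∀ u ∈ Icc P.a₀ P.a₁, ∀ v ∈ Icc P.b₀ P.b₁, G v u ≠ 0 := by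
    intro u hu v hv h
    apply notMem_characteristicLine hskew 1 (p := (u, v)) ⟨hu, hv⟩
    rw [hF v hv u hu, h, zero_add]
    exact Submodule.smul_mem _ _ (hβX v hv)
  have hβ0 : ∀ v ∈ Icc P.b₀ P.b₁, β v ≠ 0 := by
    intro v hv h
    apply notMem_characteristicLine hskew 0 (p := (P.a₀, v)) ⟨ha₀, hv⟩
    rw [hF v hv _ ha₀, h, add_zero]
    exact Submodule.smul_mem _ _ (hGX v hv _ ha₀)
  -- G lies in the plane of the conic u = const, whereas the cone vertex d u does not.
  have hGd : ∀ u ∈ Icc P.a₀ P.a₁, G P.b₀ u ∉ Submodule.span ℝ {d u} := by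
    intro u hu h
    obtain ⟨t, ht⟩ := Submodule.mem_span_singleton.1 h
    have ht0 : t ≠ 0 := by
      rintro rfl
      exact hG0 u hu _ hb₀ (by rw [← ht, zero_smul])
    apply hdM' u hu _ hb₀
    rw [← Submodule.smul_mem_iff _ ht0, ht]
    exact hGM u hu _ hb₀
  have hR : ∀ v ∈ Icc P.b₀ P.b₁, ∃ R : ℝ, ∀ u ∈ Icc P.a₀ P.a₁, G v u = R • G P.b₀ u := by
    intro v hv
    refine exists_const_of_proportional P.a_lt (hG v hv) (hG _ hb₀) ?_ (hG' v hv) (hG' _ hb₀) hGd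
    -- Both G v u and G P.b₀ u lie where the plane of the conic u = const meets the first axis,
    -- which is a single point.
    intro u hu
    obtain ⟨e, he⟩ := exists_axisProj_mem_span hskew (k := 1) (p := (u, P.b₀)) ⟨hu, hb₀⟩
    have h1 := he _ (hGM u hu _ hb₀)
    have h2 := hGM u hu v hv
    rw [supportingPlane_eq_of_mem (hl1 u hu v hv)] at h2
    replace h2 := he _ h2
    rw [axisProj_eq_self hskew (k := 1) (hGX _ hb₀ u hu)] at h1
    rw [axisProj_eq_self hskew (k := 1) (hGX v hv u hu)] at h2
    obtain ⟨s, hs⟩ := Submodule.mem_span_singleton.1 h1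
    obtain ⟨t, ht⟩ := Submodule.mem_span_singleton.1 h2
    have hs0 : s ≠ 0 := by
      rintro rfl
      exact hG0 u hu _ hb₀ (by rw [← hs, zero_smul])
    exact Submodule.mem_span_singleton.2 ⟨t * s⁻¹, by
      rw [← hs, smul_smul, inv_mul_cancel_right₀ hs0, ht]⟩
  choose! R hR using hR
  have hR0 : ∀ v ∈ Icc P.b₀ P.b₁, R v ≠ 0 := by
    intro v hv h
    exact hG0 _ ha₀ v hv (by rw [hR v hv _ ha₀, h, zero_smul])
  set a : ℝ → Vec := G P.b₀
  set b : ℝ → Vec := fun v => (R v)⁻¹ • β v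
  have hcoord : ∀ u ∈ Icc P.a₀ P.a₁, ∀ v ∈ Icc P.b₀ P.b₁,
      ∃ μ : ℝ, μ ≠ 0 ∧ P.F (u, v) = μ • (a u + b v) := by
    intro u hu v hv
    refine ⟨σ v u * R v, mul_ne_zero (hσ0 v hv u hu) (hR0 v hv), ?_⟩
    rw [hF v hv u hu, hR v hv u hu, mul_smul, smul_add (R v), smul_inv_smul₀ (hR0 v hv)]
  have hbX : ∀ v ∈ Icc P.b₀ P.b₁, b v ∈ P.characteristicLine 1 :=
    fun v hv => Submodule.smul_mem _ _ (hβX v hv)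
  have haX : ∀ u ∈ Icc P.a₀ P.a₁, a u ∈ P.characteristicLine 0 := fun u hu => hGX _ hb₀ u hu
  have hb0 : ∀ v ∈ Icc P.b₀ P.b₁, b v ≠ 0 :=
    fun v hv => smul_ne_zero (inv_ne_zero (hR0 v hv)) (hβ0 v hv)
  have haM : ∀ u ∈ Icc P.a₀ P.a₁, ∀ v ∈ Icc P.b₀ P.b₁,
      a u + b v ∈ P.supportingPlane 0 (u, v) ∧ a u + b v ∈ P.supportingPlane 1 (u, v) := by
    intro u hu v hv
    obtain ⟨μ, hμ, hFμ⟩ := hcoord u hu v hv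
    have hq : (u, v) ∈ P.rect := ⟨hu, hv⟩
    have h0 := mem_supportingPlane 0 hq
    have h1 := mem_supportingPlane 1 hq
    rw [hFμ, Submodule.smul_mem_iff _ hμ] at h0 h1
    exact ⟨h0, h1⟩
  have hbM : ∀ u ∈ Icc P.a₀ P.a₁, ∀ v ∈ Icc P.b₀ P.b₁, b v ∈ P.supportingPlane 0 (u, v) := by
    intro u hu v hv
    exact (Submodule.add_mem_iff_right _ (characteristicLine_le (p := (u, v)) ⟨hu, hv⟩
      (haX u hu))).1 (haM u hu v hv).1
  have haM' : ∀ u ∈ Icc P.a₀ P.a₁, ∀ v ∈ Icc P.b₀ P.b₁, a u ∈ P.supportingPlane 1 (u, v) := by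
    intro u hu v hv
    exact (Submodule.add_mem_iff_left _ (characteristicLine_le (p := (u, v)) ⟨hu, hv⟩
      (hbX v hv))).1 (haM u hu v hv).2
  have hspan : ∀ u ∈ Icc P.a₀ P.a₁, ∀ v ∈ Icc P.b₀ P.b₁, ∀ w : Vec,
      Submodule.span ℝ {P.F (u, v), w} = Submodule.span ℝ {a u + b v, w} := by
    intro u hu v hv w
    obtain ⟨μ, hμ, hFμ⟩ := hcoord u hu v hv
    rw [hFμ, Submodule.span_insert, Submodule.span_insert,
      Submodule.span_singleton_smul_eq (IsUnit.mk0 μ hμ)]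
  have hplane : ∀ (X W : Submodule ℝ Vec) (w : Vec), finrank ℝ X = 2 → finrank ℝ W = 3 → X ≤ W →
      w ∈ W → w ∉ X → W = X ⊔ Submodule.span ℝ {w} := by
    intro X W w hX hW hXW hw hwX
    have hle : X ⊔ Submodule.span ℝ {w} ≤ W :=
      sup_le hXW ((Submodule.span_singleton_le_iff_mem _ _).2 hw)
    have hlt : X < X ⊔ Submodule.span ℝ {w} := lt_of_le_of_ne le_sup_left fun he => hwX (by
      rw [he]; exact Submodule.mem_sup_right (Submodule.mem_span_singleton_self w))
    have h1 := Submodule.finrank_lt_finrank_of_lt hlt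
    exact (Submodule.eq_of_le_of_finrank_le hle (by omega)).symm
  have hcompl := isCompl_characteristicLine hskew 1
  have hcompl' : IsCompl (P.characteristicLine 0) (P.characteristicLine 1) := hcompl
  have hdisj : ∀ x ∈ P.characteristicLine 0, x ∈ P.characteristicLine 1 → x = 0 :=
    fun x h0 h1 => Submodule.disjoint_def.1 hcompl'.disjoint x h0 h1
  have hline : ∀ x w : Vec, x ≠ 0 → ∀ W : Submodule ℝ Vec, x ∈ W → w ∉ W →
      LinearIndependent ℝ ![x, w] := by
    intro x w hx W hxW hwW
    apply linearIndependent_pair_of_notMem hx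
    intro h
    obtain ⟨t, rfl⟩ := Submodule.mem_span_singleton.1 h
    exact hwW (Submodule.smul_mem _ _ hxW)
  refine ⟨a, d, b, c, hcompl', finrank_characteristicLine hskew 0,
    finrank_characteristicLine hskew 1, haX, hdX, hbX, hcX, ?_, ?_, hcoord, ?_, ?_, ?_, ?_, ?_, ?_,
    ?_, ?_⟩
  · exact fun u hu => hline _ _ (hG0 u hu _ hb₀) _ (haM' u hu _ hb₀) (hdM' u hu _ hb₀)
  · exact fun v hv => hline _ _ (hb0 v hv) _ (hbM _ ha₀ v hv) (hcM' _ ha₀ v hv)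
  · exact fun u hu v hv => by rw [ht0 u hu v hv, hspan u hu v hv]
  · exact fun u hu v hv => by rw [ht1 u hu v hv, hspan u hu v hv]
  · exact fun u hu v hv => hplane _ _ _ (finrank_characteristicLine hskew 0)
      (finrank_supportingPlane 0 ⟨hu, hv⟩) (characteristicLine_le ⟨hu, hv⟩) (hbM u hu v hv)
      fun h => hb0 v hv (hdisj _ h (hbX v hv))
  · exact fun u hu v hv => hplane _ _ _ (finrank_characteristicLine hskew 1)
      (finrank_supportingPlane 1 ⟨hu, hv⟩) (characteristicLine_le ⟨hu, hv⟩) (haM' u hu v hv)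
      fun h => hG0 u hu _ hb₀ (hdisj _ (haX u hu) h)
  · intro u hu v hv
    rw [← hcv v hv, coneVertex, coneVertex, paramLine_eq_of_mem (hl0 u hu v hv)]
  · intro u hu v hv
    rw [← hdv u hu, coneVertex, coneVertex, paramLine_eq_of_mem (hl1 u hu v hv)]
  · intro u hu u' hu' h
    obtain ⟨t, ht⟩ := Submodule.mem_span_singleton.1 h
    obtain ⟨B, harc⟩ := exists_isConicArc (k := 0) (p := (P.a₀, P.b₀)) ⟨ha₀, hb₀⟩
    obtain ⟨μ, hμ, hFμ⟩ := hcoord u' hu' _ hb₀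
    -- The hypothesis places the point at u' on the tangent at u, so the two points of the conic
    -- coincide. Comparing B-components, which are both b P.b₀, shows that the proportionality
    -- factor is 1.
    have h1 := harc.mem_span_of_mem_tangent (s := u) (t := u') hu hu' (by
      change P.F (u', P.b₀) ∈ tangentLine P.F 0 (u, P.b₀)
      rw [ht0 u hu _ hb₀, hspan u hu _ hb₀, hFμ]
      refine Submodule.smul_mem _ _ (Submodule.mem_span_pair.2 ⟨1, t, ?_⟩)
      rw [ht]; module)
    change P.F (u', P.b₀) ∈ Submodule.span ℝ {P.F (u, P.b₀)} at h1
    obtain ⟨ν, hν, hFν⟩ := hcoord u hu _ hb₀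
    rw [hFμ, Submodule.smul_mem_iff _ hμ, hFν,
      Submodule.span_singleton_smul_eq (IsUnit.mk0 ν hν)] at h1
    obtain ⟨κ, hκ⟩ := Submodule.mem_span_singleton.1 h1
    have h2 : κ • a u - a u' = (1 - κ) • b P.b₀ := by
      rw [← sub_eq_zero, ← sub_eq_zero.2 hκ]; module
    have h3 : (1 - κ) • b P.b₀ = 0 := hdisj _ (by
      rw [← h2]
      exact Submodule.sub_mem _ (Submodule.smul_mem _ _ (haX u hu)) (haX u' hu'))
      (Submodule.smul_mem _ _ (hbX _ hb₀))
    have h4 : κ = 1 := by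
      rcases smul_eq_zero.1 h3 with h | h
      · linarith
      · exact (hb0 _ hb₀ h).elim
    rw [h3, h4, one_smul] at h2
    exact (sub_eq_zero.1 h2).symm
  · intro u hu u' hu' h
    obtain ⟨t, ht⟩ := Submodule.mem_span_singleton.1 h
    obtain ⟨B, harc⟩ := exists_isConicArc (k := 1) (p := (P.a₀, P.b₀)) ⟨ha₀, hb₀⟩
    obtain ⟨μ, hμ, hFμ⟩ := hcoord _ ha₀ u' hu'
    have h1 := harc.mem_span_of_mem_tangent (s := u) (t := u') hu hu' (by
      change P.F (P.a₀, u') ∈ tangentLine P.F 1 (P.a₀, u)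
      rw [ht1 _ ha₀ u hu, hspan _ ha₀ u hu, hFμ]
      refine Submodule.smul_mem _ _ (Submodule.mem_span_pair.2 ⟨1, t, ?_⟩)
      rw [ht]; module)
    change P.F (P.a₀, u') ∈ Submodule.span ℝ {P.F (P.a₀, u)} at h1
    obtain ⟨ν, hν, hFν⟩ := hcoord _ ha₀ u hu
    rw [hFμ, Submodule.smul_mem_iff _ hμ, hFν,
      Submodule.span_singleton_smul_eq (IsUnit.mk0 ν hν)] at h1
    obtain ⟨κ, hκ⟩ := Submodule.mem_span_singleton.1 h1
    have h2 : (1 - κ) • a P.a₀ = κ • b u - b u' := by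
      rw [← sub_eq_zero, ← sub_eq_zero.2 hκ.symm]; module
    have h3 : (1 - κ) • a P.a₀ = 0 := hdisj _ (Submodule.smul_mem _ _ (haX _ ha₀)) (by
      rw [h2]
      exact Submodule.sub_mem _ (Submodule.smul_mem _ _ (hbX u hu)) (hbX u' hu'))
    have h4 : κ = 1 := by
      rcases smul_eq_zero.1 h3 with h | h
      · linarith
      · exact (hG0 _ ha₀ _ hb₀ h).elim
    rw [h3, h4, one_smul] at h2
    exact (sub_eq_zero.1 h2.symm).symm

end SCPatch

/-! ### Incidence of lines spanned by sums of vectors from two complementary subspaces. -/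

section Translational

variable {V : Type*} [AddCommGroup V] [Module ℝ V]

theorem linearIndependent_of_span_ne {x y : V} (hx : x ≠ 0) (hy : y ≠ 0)
    (h : Submodule.span ℝ {x} ≠ Submodule.span ℝ {y}) : LinearIndependent ℝ ![x, y] := by
  apply linearIndependent_pair_of_notMem hx
  intro hm
  obtain ⟨a, rfl⟩ := Submodule.mem_span_singleton.1 hm
  have ha : a ≠ 0 := by
    rintro rfl
    exact hy (zero_smul _ _)
  exact h (Submodule.span_singleton_smul_eq (IsUnit.mk0 a ha) x).symm

theorem exists_le_finrank_eq [FiniteDimensional ℝ V] {n : ℕ} (hn : n ≤ finrank ℝ V)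
    (U : Submodule ℝ V) (hU : finrank ℝ U ≤ n) : ∃ W, U ≤ W ∧ finrank ℝ W = n := by
  obtain ⟨m, hm⟩ := Nat.exists_eq_add_of_le hU
  induction m generalizing U with
  | zero => exact ⟨U, le_rfl, hm.symm⟩
  | succ m ih =>
    obtain ⟨z, hz⟩ : ∃ z, z ∉ U := by
      by_contra! hc
      have : U = ⊤ := eq_top_iff.2 fun v _ => hc v
      rw [this, finrank_top] at hm
      omega
    have hlt : U < U ⊔ Submodule.span ℝ {z} := lt_of_le_of_ne le_sup_left fun he => hz (by
      rw [he]; exact Submodule.mem_sup_right (Submodule.mem_span_singleton_self z))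
    have h1 := Submodule.finrank_lt_finrank_of_lt hlt
    have h2 := Submodule.finrank_add_le_finrank_add_finrank U (Submodule.span ℝ {z})
    have h3 : finrank ℝ (Submodule.span ℝ {z}) ≤ 1 := by
      simpa using finrank_span_le_card (R := ℝ) ({z} : Set V)
    obtain ⟨W, hW, hWn⟩ := ih (U ⊔ Submodule.span ℝ {z}) (by omega) (by omega)
    exact ⟨W, le_sup_left.trans hW, hWn⟩

theorem finrank_span_triple_le (x y z : V) : finrank ℝ (Submodule.span ℝ {x, y, z}) ≤ 3 := by
  classical
  have h := (finrank_span_finset_le_card (R := ℝ) ({x, y, z} : Finset V)).trans Finset.card_le_three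
  rwa [Set.finrank, Finset.coe_insert, Finset.coe_pair] at h

theorem inf_ne_bot_of_mem {L M : Submodule ℝ V} {x : V} (hx : x ≠ 0) (hL : x ∈ L) (hM : x ∈ M) :
    L ⊓ M ≠ ⊥ := fun h => hx ((Submodule.mem_bot ℝ).1 (h ▸ ⟨hL, hM⟩))

/-- Coplanar lines intersect. -/
theorem inf_ne_bot_of_le [FiniteDimensional ℝ V] {L M W : Submodule ℝ V} (hL : finrank ℝ L = 2)
    (hM : finrank ℝ M = 2) (hW : finrank ℝ W = 3) (hLW : L ≤ W) (hMW : M ≤ W) : L ⊓ M ≠ ⊥ := by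
  intro h
  have h1 := Submodule.finrank_sup_add_finrank_inf_eq L M
  have h2 := Submodule.finrank_mono (sup_le hLW hMW)
  rw [h, finrank_bot] at h1
  omega

theorem finrank_inf_eq_one [FiniteDimensional ℝ V] {L M : Submodule ℝ V} (hL : finrank ℝ L = 2)
    (h : L ⊓ M ≠ ⊥) {x : V} (hxL : x ∈ L) (hxM : x ∉ M) :
    finrank ℝ (L ⊓ M : Submodule ℝ V) = 1 := by
  have h1 : finrank ℝ (L ⊓ M : Submodule ℝ V) ≠ 0 := fun h0 => h (Submodule.finrank_eq_zero.1 h0)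
  have h2 : L ⊓ M < L := lt_of_le_of_ne inf_le_left fun he => hxM (he.ge hxL).2
  have h3 := Submodule.finrank_lt_finrank_of_lt h2
  omega

variable {A B : Submodule ℝ V}

theorem eq_and_eq_of_add_eq_add (hAB : Disjoint A B) {x x' y y' : V} (hx : x ∈ A) (hx' : x' ∈ A)
    (hy : y ∈ B) (hy' : y' ∈ B) (h : x + y = x' + y') : x = x' ∧ y = y' := by
  have h1 : x - x' = y' - y := by
    rw [← sub_eq_zero, ← sub_eq_zero.2 h]; abel
  have h2 : x - x' = 0 :=
    Submodule.disjoint_def.1 hAB _ (A.sub_mem hx hx') (h1 ▸ B.sub_mem hy' hy)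
  exact ⟨sub_eq_zero.1 h2, (sub_eq_zero.1 (h1 ▸ h2)).symm⟩

variable {a a' d d' b b' c : V}

theorem eq_of_smul_add_eq (hli : LinearIndependent ℝ ![a, d]) {p q r s : ℝ}
    (h : p • a + q • d = r • a + s • d) : p = r ∧ q = s := by
  have := LinearIndependent.pair_iff.1 hli (p - r) (q - s) (by
    rw [← sub_eq_zero.2 h]; module)
  exact ⟨sub_eq_zero.1 this.1, sub_eq_zero.1 this.2⟩

theorem eq_zero_of_smul_eq_smul (hli : LinearIndependent ℝ ![a, d]) {p q : ℝ}
    (h : p • a = q • d) : p = 0 ∧ q = 0 := by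
  have := LinearIndependent.pair_iff.1 hli p (-q) (by rw [h]; module)
  exact ⟨this.1, neg_eq_zero.1 this.2⟩

/-- In a common vector the B-components annihilate the coefficients of a + b and a' + b', and then
the A-components annihilate those of d and d'. -/
theorem inf_eq_bot_of_opposite (hAB : Disjoint A B) (ha : a ∈ A) (ha' : a' ∈ A) (hd : d ∈ A)
    (hd' : d' ∈ A) (hb : b ∈ B) (hb' : b' ∈ B) (hbb : LinearIndependent ℝ ![b, b'])
    (hdd : LinearIndependent ℝ ![d, d']) :
    Submodule.span ℝ {a + b, d} ⊓ Submodule.span ℝ {a' + b', d'} = ⊥ := by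
  rw [eq_bot_iff]
  rintro x ⟨h1, h2⟩
  obtain ⟨p, q, rfl⟩ := Submodule.mem_span_pair.1 h1
  obtain ⟨r, s, h⟩ := Submodule.mem_span_pair.1 h2
  obtain ⟨hA, hB⟩ := eq_and_eq_of_add_eq_add hAB (x := p • a + q • d) (x' := r • a' + s • d')
    (y := p • b) (y' := r • b') (A.add_mem (A.smul_mem _ ha) (A.smul_mem _ hd))
    (A.add_mem (A.smul_mem _ ha') (A.smul_mem _ hd')) (B.smul_mem _ hb) (B.smul_mem _ hb')
    (by rw [← sub_eq_zero, ← sub_eq_zero.2 h.symm]; module)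
  obtain ⟨rfl, rfl⟩ := eq_zero_of_smul_eq_smul hbb hB
  simp only [zero_smul, zero_add] at hA
  obtain ⟨rfl, rfl⟩ := eq_zero_of_smul_eq_smul hdd hA
  simp

/-- Independence of b and c equates the coefficients of a + b and a' + b; if that coefficient were
nonzero, a' - a would be parallel to d. -/
theorem inf_eq_bot_of_mixed (hAB : Disjoint A B) (ha : a ∈ A) (ha' : a' ∈ A) (hd : d ∈ A)
    (hb : b ∈ B) (hc : c ∈ B) (hbc : LinearIndependent ℝ ![b, c])
    (hda : a' - a ∉ Submodule.span ℝ {d}) :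
    Submodule.span ℝ {a + b, d} ⊓ Submodule.span ℝ {a' + b, c} = ⊥ := by
  rw [eq_bot_iff]
  rintro x ⟨h1, h2⟩
  obtain ⟨p, q, rfl⟩ := Submodule.mem_span_pair.1 h1
  obtain ⟨r, s, h⟩ := Submodule.mem_span_pair.1 h2
  obtain ⟨hA, hB⟩ := eq_and_eq_of_add_eq_add hAB (x := p • a + q • d) (x' := r • a')
    (y := p • b) (y' := r • b + s • c) (A.add_mem (A.smul_mem _ ha) (A.smul_mem _ hd))
    (A.smul_mem _ ha') (B.smul_mem _ hb) (B.add_mem (B.smul_mem _ hb) (B.smul_mem _ hc))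
    (by rw [← sub_eq_zero, ← sub_eq_zero.2 h.symm]; module)
  obtain ⟨rfl, rfl⟩ := eq_of_smul_add_eq hbc (p := p) (q := 0) (by rw [← hB]; module)
  by_cases hp : p = 0
  · subst hp
    simp only [zero_smul, zero_add] at hA
    simp [hA]
  · refine (hda (Submodule.mem_span_singleton.2 ⟨p⁻¹ * q, ?_⟩)).elim
    have h3 : q • d = p • (a' - a) := by
      rw [smul_sub, ← hA]; abel
    rw [mul_smul, h3, inv_smul_smul₀ hp]

/-- The intersection point of two affine lines in a plane, in homogeneous form. -/
theorem exists_affine_inter [FiniteDimensional ℝ V] (hA2 : finrank ℝ A = 2) (ha : a ∈ A)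
    (ha' : a' ∈ A) (hd : d ∈ A) (hd' : d' ∈ A) (hdd : LinearIndependent ℝ ![d, d']) :
    ∃ w ∈ A, (∃ x : ℝ, w = a + x • d) ∧ (∃ x : ℝ, w = a' + x • d') ∧
      ∀ p q r : ℝ, p • a + q • d = p • a' + r • d' → p • a + q • d = p • w := by
  have h1 : a' - a ∈ Submodule.span ℝ {d, d'} := by
    rw [span_pair_eq_of_linearIndependent hA2 hdd hd hd']
    exact A.sub_mem ha' ha
  obtain ⟨x, y, hxy⟩ := Submodule.mem_span_pair.1 h1
  refine ⟨a + x • d, A.add_mem ha (A.smul_mem _ hd), ⟨x, rfl⟩, ⟨-y, ?_⟩, fun p q r h => ?_⟩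
  · have : a' = a + (x • d + y • d') := by rw [hxy]; abel
    rw [this]; module
  · have h2 : q • d + (-r) • d' = (p * x) • d + (p * y) • d' := by
      have h3 : q • d + (-r) • d' = p • (a' - a) := by
        rw [← sub_eq_zero, ← sub_eq_zero.2 h]; module
      rw [h3, ← hxy]; module
    rw [(eq_of_smul_add_eq hdd h2).1]; module

theorem mem_of_mem_of_mem (hAB : Disjoint A B) (ha : a ∈ A) (ha' : a' ∈ A) (hb : b ∈ B)
    (hc : c ∈ B) (haa : LinearIndependent ℝ ![a, a']) :
    Submodule.span ℝ {a + b, c} ⊓ Submodule.span ℝ {a' + b, c} ≤ B := by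
  rintro x ⟨h1, h2⟩
  obtain ⟨p, q, rfl⟩ := Submodule.mem_span_pair.1 h1
  obtain ⟨r, s, h⟩ := Submodule.mem_span_pair.1 h2
  obtain ⟨hA, -⟩ := eq_and_eq_of_add_eq_add hAB (x := p • a) (x' := r • a')
    (y := p • b + q • c) (y' := r • b + s • c) (A.smul_mem _ ha) (A.smul_mem _ ha')
    (B.add_mem (B.smul_mem _ hb) (B.smul_mem _ hc)) (B.add_mem (B.smul_mem _ hb) (B.smul_mem _ hc))
    (by rw [← sub_eq_zero, ← sub_eq_zero.2 h.symm]; module)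
  obtain ⟨rfl, rfl⟩ := eq_zero_of_smul_eq_smul haa hA
  rw [zero_smul, zero_add]
  exact B.smul_mem _ hc

/-- Equal B-components give both sums the same coefficient p, so the common vector is p (w + b). -/
theorem inf_le_of_affine_inter (hAB : Disjoint A B) (ha : a ∈ A) (ha' : a' ∈ A) (hd : d ∈ A)
    (hd' : d' ∈ A) (hb : b ∈ B) (hb0 : b ≠ 0) {w : V}
    (hw : ∀ p q r : ℝ, p • a + q • d = p • a' + r • d' → p • a + q • d = p • w) :
    Submodule.span ℝ {a + b, d} ⊓ Submodule.span ℝ {a' + b, d'} ≤ B ⊔ Submodule.span ℝ {w} := by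
  rintro x ⟨h1, h2⟩
  obtain ⟨p, q, rfl⟩ := Submodule.mem_span_pair.1 h1
  obtain ⟨r, s, h⟩ := Submodule.mem_span_pair.1 h2
  obtain ⟨hA, hB⟩ := eq_and_eq_of_add_eq_add hAB (x := p • a + q • d) (x' := r • a' + s • d')
    (y := p • b) (y' := r • b) (A.add_mem (A.smul_mem _ ha) (A.smul_mem _ hd))
    (A.add_mem (A.smul_mem _ ha') (A.smul_mem _ hd')) (B.smul_mem _ hb) (B.smul_mem _ hb)
    (by rw [← sub_eq_zero, ← sub_eq_zero.2 h.symm]; module)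
  obtain rfl : p = r := smul_left_injective ℝ hb0 hB
  have h3 : p • (a + b) + q • d = p • b + p • w := by
    rw [← hw p q s hA]; module
  rw [h3]
  exact Submodule.add_mem_sup (B.smul_mem _ hb)
    (Submodule.smul_mem _ _ (Submodule.mem_span_singleton_self _))

theorem inf_le_span_add (hAB : Disjoint A B) (ha : a ∈ A) (hd : d ∈ A) (hb : b ∈ B) (hc : c ∈ B)
    (had : LinearIndependent ℝ ![a, d]) :
    Submodule.span ℝ {a + b, d} ⊓ Submodule.span ℝ {a + b, c} ≤ Submodule.span ℝ {a + b} := by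
  rintro x ⟨h1, h2⟩
  obtain ⟨p, q, rfl⟩ := Submodule.mem_span_pair.1 h1
  obtain ⟨r, s, h⟩ := Submodule.mem_span_pair.1 h2
  obtain ⟨hA, -⟩ := eq_and_eq_of_add_eq_add hAB (x := p • a + q • d) (x' := r • a)
    (y := p • b) (y' := r • b + s • c) (A.add_mem (A.smul_mem _ ha) (A.smul_mem _ hd))
    (A.smul_mem _ ha) (B.smul_mem _ hb) (B.add_mem (B.smul_mem _ hb) (B.smul_mem _ hc))
    (by rw [← sub_eq_zero, ← sub_eq_zero.2 h.symm]; module)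
  obtain ⟨-, rfl⟩ := eq_of_smul_add_eq had (r := r) (s := 0) (by rw [hA]; module)
  rw [zero_smul, add_zero]
  exact Submodule.smul_mem _ _ (Submodule.mem_span_singleton_self _)

theorem notMem_tangent_of_indep (hAB : Disjoint A B) (ha : a ∈ A) (hd : d ∈ A) (hd' : d' ∈ A)
    (hb : b ∈ B) (hb0 : b ≠ 0) (hdd : LinearIndependent ℝ ![d, d']) :
    d' ∉ Submodule.span ℝ {a + b, d} := by
  intro h
  obtain ⟨p, q, h⟩ := Submodule.mem_span_pair.1 h
  obtain ⟨hA, hB⟩ := eq_and_eq_of_add_eq_add hAB (x := p • a + q • d) (x' := d')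
    (y := p • b) (y' := 0) (A.add_mem (A.smul_mem _ ha) (A.smul_mem _ hd)) hd'
    (B.smul_mem _ hb) B.zero_mem (by rw [add_zero, ← h]; module)
  obtain rfl : p = 0 := (smul_eq_zero.1 hB).resolve_right hb0
  rw [zero_smul, zero_add] at hA
  exact notMem_span_of_linearIndependent_pair hdd (Submodule.mem_span_singleton.2 ⟨q, hA⟩)

theorem notMem_conjugate_of_indep (hAB : Disjoint A B) (ha : a ∈ A) (ha' : a' ∈ A) (hb : b ∈ B)
    (hb' : b' ∈ B) (hc : c ∈ B) (haa : LinearIndependent ℝ ![a, a']) :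
    a' + b' ∉ Submodule.span ℝ {a + b, c} := by
  intro h
  obtain ⟨p, q, h⟩ := Submodule.mem_span_pair.1 h
  obtain ⟨hA, -⟩ := eq_and_eq_of_add_eq_add hAB (x := p • a) (x' := a')
    (y := p • b + q • c) (y' := b') (A.smul_mem _ ha) ha'
    (B.add_mem (B.smul_mem _ hb) (B.smul_mem _ hc)) hb'
    (by rw [← sub_eq_zero, ← sub_eq_zero.2 h]; module)
  exact notMem_span_of_linearIndependent_pair haa (Submodule.mem_span_singleton.2 ⟨p, hA⟩)

theorem add_ne_zero_of_disjoint (hAB : Disjoint A B) (ha : a ∈ A) (hb : b ∈ B) (hb0 : b ≠ 0) :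
    a + b ≠ 0 := fun h =>
  hb0 (eq_and_eq_of_add_eq_add hAB ha A.zero_mem hb B.zero_mem (h.trans (add_zero 0).symm)).2

end Translational

/-! ### Perspectivity and the Laplace points. -/

theorem perspectiveFrom_of_span {A B : Submodule ℝ Vec} (hAB : Disjoint A B) {a a' b : Vec}
    (ha : a ∈ A) (ha' : a' ∈ A) (hb : b ∈ B) (hb0 : b ≠ 0) (haa : a' - a ≠ 0) {o x y : RP3}
    (ho : o.submodule = Submodule.span ℝ {a' - a}) (hx : x.submodule = Submodule.span ℝ {a + b})
    (hy : y.submodule = Submodule.span ℝ {a' + b}) : PerspectiveFrom o x y := by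
  have key : ∀ e ∈ A, a' - a ∉ Submodule.span ℝ {e + b} := by
    intro e he h
    obtain ⟨p, h⟩ := Submodule.mem_span_singleton.1 h
    obtain ⟨hA, hB⟩ := eq_and_eq_of_add_eq_add hAB (x := p • e) (x' := a' - a) (y := p • b)
      (y' := 0) (A.smul_mem _ he) (A.sub_mem ha' ha) (B.smul_mem _ hb) B.zero_mem
      (by rw [add_zero, ← h]; module)
    obtain rfl : p = 0 := (smul_eq_zero.1 hB).resolve_right hb0
    exact haa (by rw [← hA, zero_smul])
  refine ⟨?_, ?_, ?_, ?_⟩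
  · rintro rfl
    apply key a ha
    have h1 : a' + b ∈ Submodule.span ℝ {a + b} := by
      rw [← hx, hy]; exact Submodule.mem_span_singleton_self _
    have h2 := Submodule.sub_mem _ h1 (Submodule.mem_span_singleton_self (a + b))
    rwa [add_sub_add_right_eq_sub] at h2
  · rintro rfl
    apply key a ha
    rw [← hx, ho]
    exact Submodule.mem_span_singleton_self _
  · rintro rfl
    apply key a' ha'
    rw [← hy, ho]
    exact Submodule.mem_span_singleton_self _
  · rw [join, ho, hx, hy, ← Submodule.span_insert, Submodule.span_singleton_le_iff_mem,
      Submodule.mem_span_pair]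
    exact ⟨-1, 1, by module⟩

/-- The Laplace point of a planar quadrilateral given by sums of vectors. -/
theorem exists_laplacePoint {a a' b b' : Vec} {x₀₀ x₁₀ x₀₁ x₁₁ : RP3}
    (h₀₀ : x₀₀.submodule = Submodule.span ℝ {a + b})
    (h₁₀ : x₁₀.submodule = Submodule.span ℝ {a' + b})
    (h₀₁ : x₀₁.submodule = Submodule.span ℝ {a + b'})
    (h₁₁ : x₁₁.submodule = Submodule.span ℝ {a' + b'})
    (hnc : ∀ l : Submodule ℝ Vec, finrank ℝ l ≤ 2 → x₀₀.submodule ≤ l → x₁₀.submodule ≤ l →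
      x₀₁.submodule ≤ l → x₁₁.submodule ≤ l → False) :
    a' - a ≠ 0 ∧ ∃ y : RP3, y.submodule = Submodule.span ℝ {a' - a} ∧
      join x₀₀ x₁₀ ⊓ join x₀₁ x₁₁ = y.submodule := by
  have hne : a' - a ≠ 0 := by
    intro h
    obtain rfl : a' = a := sub_eq_zero.1 h
    have hm : ∀ w ∈ ({a' + b, a' + b'} : Set Vec),
        Submodule.span ℝ {w} ≤ Submodule.span ℝ {a' + b, a' + b'} := fun w hw =>
      Submodule.span_mono (Set.singleton_subset_iff.2 hw)
    refine hnc _ (finrank_span_pair_le (a' + b) (a' + b')) ?_ ?_ ?_ ?_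
    · rw [h₀₀]; exact hm _ (by simp)
    · rw [h₁₀]; exact hm _ (by simp)
    · rw [h₀₁]; exact hm _ (by simp)
    · rw [h₁₁]; exact hm _ (by simp)
  refine ⟨hne, Projectivization.mk ℝ _ hne, Projectivization.submodule_mk _ _, ?_⟩
  have h1 : join x₀₀ x₁₀ = Submodule.span ℝ {a + b, a' + b} := by
    rw [join, h₀₀, h₁₀, ← Submodule.span_insert]
  have h2 : join x₀₁ x₁₁ = Submodule.span ℝ {a + b', a' + b'} := by
    rw [join, h₀₁, h₁₁, ← Submodule.span_insert]
  have h3 := Submodule.finrank_sup_add_finrank_inf_eq (join x₀₀ x₁₀) (join x₀₁ x₁₁)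
  have h4 : ¬ finrank ℝ (join x₀₀ x₁₀ ⊔ join x₀₁ x₁₁ : Submodule ℝ Vec) ≤ 2 := fun h =>
    hnc _ h (le_sup_left.trans le_sup_left) (le_sup_right.trans le_sup_left)
      (le_sup_left.trans le_sup_right) (le_sup_right.trans le_sup_right)
  have h5 : finrank ℝ (join x₀₀ x₁₀) ≤ 2 := by rw [h1]; exact finrank_span_pair_le _ _
  have h6 : finrank ℝ (join x₀₁ x₁₁) ≤ 2 := by rw [h2]; exact finrank_span_pair_le _ _
  rw [Projectivization.submodule_mk]
  -- The sides have rank at most 2 and their join at least 3 by non-collinearity, so they share at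
  -- most one point; a' - a is one.
  refine (Submodule.eq_of_le_of_finrank_le ?_ ?_).symm
  · rw [Submodule.span_singleton_le_iff_mem]
    refine ⟨?_, ?_⟩
    · rw [h1]; exact Submodule.mem_span_pair.2 ⟨-1, 1, by module⟩
    · rw [h2]; exact Submodule.mem_span_pair.2 ⟨-1, 1, by module⟩
  · rw [finrank_span_singleton hne]
    omega

/-! ### Vertices, tangents and tangent planes at the four corners. -/

namespace SCPatch

variable {P : SCPatch}

/-- The vertices, tangents and tangent planes of a patch at its corners, in terms of vectors of two
complementary planes. -/
structure IsCornerFrame (P : SCPatch) (A B : Submodule ℝ Vec) (a d b c : Fin 2 → Vec) : Prop where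
  disjoint : Disjoint A B
  finrank_left : finrank ℝ A = 2
  finrank_right : finrank ℝ B = 2
  a_mem : ∀ i, a i ∈ A
  d_mem : ∀ i, d i ∈ A
  b_mem : ∀ j, b j ∈ B
  c_mem : ∀ j, c j ∈ B
  indep_left : ∀ i, LinearIndependent ℝ ![a i, d i]
  indep_right : ∀ j, LinearIndependent ℝ ![b j, c j]
  vertex_eq : ∀ i j, (P.vertex i j).submodule = Submodule.span ℝ {a i + b j}
  tangent_zero : ∀ i j, P.tangent 0 i j = Submodule.span ℝ {a i + b j, d i}
  tangent_one : ∀ i j, P.tangent 1 i j = Submodule.span ℝ {a i + b j, c j}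
  eq_left : ∀ i i', a i' - a i ∈ Submodule.span ℝ {d i} → a i' = a i
  eq_right : ∀ j j', b j' - b j ∈ Submodule.span ℝ {c j} → b j' = b j
  generic : P.GenericBoundary → LinearIndependent ℝ ![a 0, a 1] ∧ LinearIndependent ℝ ![b 0, b 1] ∧
    LinearIndependent ℝ ![d 0, d 1] ∧ LinearIndependent ℝ ![c 0, c 1]

theorem param_mem_left (i : Fin 2) : ![P.a₀, P.a₁] i ∈ Icc P.a₀ P.a₁ := by
  fin_cases i
  · exact left_mem_Icc.2 P.a_lt.le
  · exact right_mem_Icc.2 P.a_lt.le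

theorem param_mem_right (j : Fin 2) : ![P.b₀, P.b₁] j ∈ Icc P.b₀ P.b₁ := by
  fin_cases j
  · exact left_mem_Icc.2 P.b_lt.le
  · exact right_mem_Icc.2 P.b_lt.le

theorem corner_mem (i j : Fin 2) : P.corner i j ∈ P.rect := ⟨param_mem_left i, param_mem_right j⟩

theorem tangentPlane_eq_sup (i j : Fin 2) :
    tangentPlane P.F (P.corner i j) = P.tangent 0 i j ⊔ P.tangent 1 i j := by
  rw [tangent, tangent, tangentLine, tangentLine, tangentPlane, ← Submodule.span_union]
  congr 1
  ext x
  simp only [mem_insert_iff, mem_singleton_iff, mem_union]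
  tauto

theorem tangent_le_supportingPlane (k i j : Fin 2) :
    P.tangent k i j ≤ P.supportingPlane k (P.corner i j) :=
  tangentLine_le_supportingPlane k (corner_mem i j)

theorem finrank_tangent (k i j : Fin 2) : finrank ℝ (P.tangent k i j) = 2 :=
  P.characteristic.finrank_tangentLine (mem_U (corner_mem i j)) k

/-- Both tangents lie in the plane of one boundary conic. -/
theorem tangent_zero_inf_ne_bot (i i' j : Fin 2) : P.tangent 0 i j ⊓ P.tangent 0 i' j ≠ ⊥ := by
  refine inf_ne_bot_of_le (finrank_tangent 0 i j) (finrank_tangent 0 i' j)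
    (finrank_supportingPlane 0 (corner_mem i j)) (tangent_le_supportingPlane 0 i j) ?_
  rw [← supportingPlane_eq_of_mem (k := 0) (p := P.corner i j) (q := P.corner i' j)
    ⟨corner_mem i' j, rfl⟩]
  exact tangent_le_supportingPlane 0 i' j

theorem tangent_one_inf_ne_bot (i j j' : Fin 2) : P.tangent 1 i j ⊓ P.tangent 1 i j' ≠ ⊥ := by
  refine inf_ne_bot_of_le (finrank_tangent 1 i j) (finrank_tangent 1 i j')
    (finrank_supportingPlane 1 (corner_mem i j)) (tangent_le_supportingPlane 1 i j) ?_
  rw [← supportingPlane_eq_of_mem (k := 1) (p := P.corner i j) (q := P.corner i j')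
    ⟨corner_mem i j', rfl⟩]
  exact tangent_le_supportingPlane 1 i j'

theorem IsTranslational.submodule_eq {A B : Submodule ℝ Vec} {a d b c : ℝ → Vec}
    (h : P.IsTranslational A B a d b c) {u v : ℝ} (hu : u ∈ Icc P.a₀ P.a₁)
    (hv : v ∈ Icc P.b₀ P.b₁) : (P.f (u, v)).submodule = Submodule.span ℝ {a u + b v} := by
  obtain ⟨h0, h1⟩ := P.characteristic.lift (u, v) (mem_U ⟨hu, hv⟩)
  obtain ⟨μ, hμ, hF⟩ := h.coord u hu v hv
  rw [h1, Projectivization.submodule_mk, hF, Submodule.span_singleton_smul_eq (IsUnit.mk0 μ hμ)]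

theorem IsTranslational.isCornerFrame {A B : Submodule ℝ Vec} {a d b c : ℝ → Vec}
    (h : P.IsTranslational A B a d b c) :
    P.IsCornerFrame A B (fun i => a (![P.a₀, P.a₁] i)) (fun i => d (![P.a₀, P.a₁] i))
      (fun j => b (![P.b₀, P.b₁] j)) (fun j => c (![P.b₀, P.b₁] j)) where
  disjoint := h.isCompl.disjoint
  finrank_left := h.finrank_left
  finrank_right := h.finrank_right
  a_mem i := h.a_mem _ (param_mem_left i)
  d_mem i := h.d_mem _ (param_mem_left i)
  b_mem j := h.b_mem _ (param_mem_right j)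
  c_mem j := h.c_mem _ (param_mem_right j)
  indep_left i := h.indep_left _ (param_mem_left i)
  indep_right j := h.indep_right _ (param_mem_right j)
  vertex_eq i j := h.submodule_eq (param_mem_left i) (param_mem_right j)
  tangent_zero i j := h.tangent_left _ (param_mem_left i) _ (param_mem_right j)
  tangent_one i j := h.tangent_right _ (param_mem_left i) _ (param_mem_right j)
  eq_left i i' := h.eq_left _ (param_mem_left i) _ (param_mem_left i')
  eq_right j j' := h.eq_right _ (param_mem_right j) _ (param_mem_right j')
  generic hg := by
    -- The planes are A ⊔ span {b j} and B ⊔ span {a i}, the cone vertices c j and d i. Distinctness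
    -- in each family thus becomes independence of a pair.
    obtain ⟨hW0, hc⟩ := hg 0
    obtain ⟨hW1, hd⟩ := hg 1
    have hu := fun i => param_mem_left (P := P) i
    have hv := fun j => param_mem_right (P := P) j
    rw [corner, corner, h.plane_left _ (hu 0) _ (hv 0), h.plane_left _ (hu 1) _ (hv 1)] at hW0
    rw [corner, corner, h.plane_right _ (hu 0) _ (hv 0), h.plane_right _ (hu 1) _ (hv 1)] at hW1
    rw [corner, corner, h.vertex_left _ (hu 0) _ (hv 0), h.vertex_left _ (hu 1) _ (hv 1)] at hc
    rw [corner, corner, h.vertex_right _ (hu 0) _ (hv 0), h.vertex_right _ (hu 1) _ (hv 1)] at hd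
    refine ⟨linearIndependent_of_span_ne ((h.indep_left _ (hu 0)).ne_zero 0)
      ((h.indep_left _ (hu 1)).ne_zero 0) fun he => hW1 ?_,
      linearIndependent_of_span_ne ((h.indep_right _ (hv 0)).ne_zero 0)
      ((h.indep_right _ (hv 1)).ne_zero 0) fun he => hW0 ?_,
      linearIndependent_of_span_ne ((h.indep_left _ (hu 0)).ne_zero 1)
      ((h.indep_left _ (hu 1)).ne_zero 1) hd,
      linearIndependent_of_span_ne ((h.indep_right _ (hv 0)).ne_zero 1)
      ((h.indep_right _ (hv 1)).ne_zero 1) hc⟩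
    · exact congrArg (B ⊔ ·) he
    · exact congrArg (A ⊔ ·) he

namespace IsCornerFrame

variable {A B : Submodule ℝ Vec} {a d b c : Fin 2 → Vec}

theorem b_ne_zero (h : P.IsCornerFrame A B a d b c) (j : Fin 2) : b j ≠ 0 :=
  (h.indep_right j).ne_zero 0

theorem a_ne_zero (h : P.IsCornerFrame A B a d b c) (i : Fin 2) : a i ≠ 0 :=
  (h.indep_left i).ne_zero 0

theorem c_ne_zero (h : P.IsCornerFrame A B a d b c) (j : Fin 2) : c j ≠ 0 :=
  (h.indep_right j).ne_zero 1

theorem d_ne_zero (h : P.IsCornerFrame A B a d b c) (i : Fin 2) : d i ≠ 0 :=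
  (h.indep_left i).ne_zero 1

theorem vertices_coplanar (h : P.IsCornerFrame A B a d b c) :
    ∃ W : Submodule ℝ Vec, finrank ℝ W = 3 ∧ ∀ i j, (P.vertex i j).submodule ≤ W := by
  obtain ⟨W, hW, hW3⟩ := exists_le_finrank_eq (n := 3) (by rw [finrank_vec]; omega) _
    (finrank_span_triple_le (a 0 + b 0) (a 1 - a 0) (b 1 - b 0))
  refine ⟨W, hW3, fun i j => ?_⟩
  rw [h.vertex_eq, Submodule.span_singleton_le_iff_mem]
  apply hW
  rw [Submodule.mem_span_triple]
  -- The vertices are a₀ + b₀ plus i times a₁ - a₀ plus j times b₁ - b₀.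
  refine ⟨1, ![0, 1] i, ![0, 1] j, ?_⟩
  fin_cases i <;> fin_cases j <;> simp <;> abel

theorem d_mem_tangent (h : P.IsCornerFrame A B a d b c) (i j : Fin 2) : d i ∈ P.tangent 0 i j := by
  rw [h.tangent_zero]; exact Submodule.subset_span (by simp)

theorem c_mem_tangent (h : P.IsCornerFrame A B a d b c) (i j : Fin 2) : c j ∈ P.tangent 1 i j := by
  rw [h.tangent_one]; exact Submodule.subset_span (by simp)

theorem add_mem_tangent (h : P.IsCornerFrame A B a d b c) (k i j : Fin 2) :
    a i + b j ∈ P.tangent k i j := by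
  fin_cases k
  · exact (h.tangent_zero i j).ge (Submodule.subset_span (by simp))
  · exact (h.tangent_one i j).ge (Submodule.subset_span (by simp))

theorem tangent_cyclic (h : P.IsCornerFrame A B a d b c) (k : Fin 2) :
    P.tangent k 0 0 ⊓ P.tangent k 1 0 ≠ ⊥ ∧ P.tangent k 1 0 ⊓ P.tangent k 1 1 ≠ ⊥ ∧
      P.tangent k 1 1 ⊓ P.tangent k 0 1 ≠ ⊥ ∧ P.tangent k 0 1 ⊓ P.tangent k 0 0 ≠ ⊥ := by
  have h0 : ∀ i j j', P.tangent 0 i j ⊓ P.tangent 0 i j' ≠ ⊥ := fun i j j' =>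
    inf_ne_bot_of_mem (h.d_ne_zero i) (h.d_mem_tangent i j) (h.d_mem_tangent i j')
  have h1 : ∀ i i' j, P.tangent 1 i j ⊓ P.tangent 1 i' j ≠ ⊥ := fun i i' j =>
    inf_ne_bot_of_mem (h.c_ne_zero j) (h.c_mem_tangent i j) (h.c_mem_tangent i' j)
  fin_cases k
  · exact ⟨tangent_zero_inf_ne_bot _ _ _, h0 _ _ _, tangent_zero_inf_ne_bot _ _ _, h0 _ _ _⟩
  · exact ⟨h1 _ _ _, tangent_one_inf_ne_bot _ _ _, h1 _ _ _, tangent_one_inf_ne_bot _ _ _⟩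

theorem exists_common_point (h : P.IsCornerFrame A B a d b c) :
    ∃ z : RP3, ∀ i j, z.submodule ≤ tangentPlane P.F (P.corner i j) := by
  suffices hz : ∃ z : Vec, z ≠ 0 ∧ ∀ i j, z ∈ P.tangent 0 i j ⊔ P.tangent 1 i j by
    obtain ⟨z, hz0, hz⟩ := hz
    refine ⟨Projectivization.mk ℝ z hz0, fun i j => ?_⟩
    rw [Projectivization.submodule_mk, Submodule.span_singleton_le_iff_mem, tangentPlane_eq_sup]
    exact hz i j
  -- If the directions d are proportional, w need not exist; then d 1 lies on all four tangents of
  -- direction 0. The same happens for c.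
  by_cases hd : d 1 ∈ Submodule.span ℝ {d 0}
  · obtain ⟨t, ht⟩ := Submodule.mem_span_singleton.1 hd
    refine ⟨d 1, h.d_ne_zero 1, fun i j => Submodule.mem_sup_left ?_⟩
    fin_cases i
    · exact ht ▸ Submodule.smul_mem _ t (h.d_mem_tangent 0 j)
    · exact h.d_mem_tangent 1 j
  by_cases hc : c 1 ∈ Submodule.span ℝ {c 0}
  · obtain ⟨t, ht⟩ := Submodule.mem_span_singleton.1 hc
    refine ⟨c 1, h.c_ne_zero 1, fun i j => Submodule.mem_sup_right ?_⟩
    fin_cases j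
    · exact ht ▸ Submodule.smul_mem _ t (h.c_mem_tangent i 0)
    · exact h.c_mem_tangent i 1
  obtain ⟨w, hwA, ⟨x₀, hx₀⟩, ⟨x₁, hx₁⟩, -⟩ := exists_affine_inter h.finrank_left (h.a_mem 0)
    (h.a_mem 1) (h.d_mem 0) (h.d_mem 1) (linearIndependent_pair_of_notMem (h.d_ne_zero 0) hd)
  obtain ⟨w', hwB, ⟨y₀, hy₀⟩, ⟨y₁, hy₁⟩, -⟩ := exists_affine_inter h.finrank_right (h.b_mem 0)
    (h.b_mem 1) (h.c_mem 0) (h.c_mem 1) (linearIndependent_pair_of_notMem (h.c_ne_zero 0) hc)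
  have hx : ∀ i, ∃ x : ℝ, w = a i + x • d i := Fin.forall_fin_two.2 ⟨⟨x₀, hx₀⟩, ⟨x₁, hx₁⟩⟩
  have hy : ∀ j, ∃ y : ℝ, w' = b j + y • c j := Fin.forall_fin_two.2 ⟨⟨y₀, hy₀⟩, ⟨y₁, hy₁⟩⟩
  refine ⟨w + w', add_ne_zero_of_disjoint h.disjoint hwA hwB fun h0 => ?_, fun i j => ?_⟩
  · have := LinearIndependent.pair_iff.1 (h.indep_right 0) 1 y₀ (by rw [one_smul, ← hy₀, h0])
    exact one_ne_zero this.1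
  · obtain ⟨x, hx⟩ := hx i
    obtain ⟨y, hy⟩ := hy j
    -- This one vector lies in every tangent plane, because w = a i + x d i and w' = b j + y c j for
    -- each i and j.
    have : w + w' = ((a i + b j) + x • d i) + y • c j := by rw [hx, hy]; abel
    rw [this]
    exact Submodule.add_mem_sup (Submodule.add_mem _ (h.add_mem_tangent 0 i j)
      (Submodule.smul_mem _ _ (h.d_mem_tangent i j))) (Submodule.smul_mem _ _ (h.c_mem_tangent i j))

theorem exists_unique_common_point (h : P.IsCornerFrame A B a d b c) (hg : P.GenericBoundary) :
    ∃ z : RP3, ⨅ i, ⨅ j, tangentPlane P.F (P.corner i j) = z.submodule := by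
  obtain ⟨z, hz⟩ := h.exists_common_point
  refine ⟨z, (Submodule.eq_of_le_of_finrank_le (le_iInf₂ hz) ?_).symm⟩
  rw [Projectivization.finrank_submodule]
  obtain ⟨-, -, hd, hc⟩ := h.generic hg
  obtain ⟨w, -, -, -, hw⟩ := exists_affine_inter h.finrank_left (h.a_mem 0)
    (h.a_mem 1) (h.d_mem 0) (h.d_mem 1) hd
  obtain ⟨w', -, -, -, hw'⟩ := exists_affine_inter h.finrank_right (h.b_mem 0)
    (h.b_mem 1) (h.c_mem 0) (h.c_mem 1) hc
  refine le_trans (Submodule.finrank_mono (t := Submodule.span ℝ {w + w'}) fun x hx => ?_) (by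
    simpa using finrank_span_le_card (R := ℝ) ({w + w'} : Set Vec))
  simp only [Submodule.mem_iInf, tangentPlane_eq_sup] at hx
  have hx' : ∀ i j, ∃ p q r : ℝ, x = (p • a i + q • d i) + (p • b j + r • c j) := by
    intro i j
    obtain ⟨y, hy, y', hy', hyy⟩ := Submodule.mem_sup.1 (hx i j)
    rw [h.tangent_zero] at hy
    rw [h.tangent_one] at hy'
    obtain ⟨p, q, rfl⟩ := Submodule.mem_span_pair.1 hy
    obtain ⟨p', r, rfl⟩ := Submodule.mem_span_pair.1 hy'
    exact ⟨p + p', q, r, by rw [← hyy]; module⟩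
  choose p q r hpqr using hx'
  have hA : ∀ i j, p i j • a i + q i j • d i ∈ A := fun i j =>
    A.add_mem (A.smul_mem _ (h.a_mem i)) (A.smul_mem _ (h.d_mem i))
  have hB : ∀ i j, p i j • b j + r i j • c j ∈ B := fun i j =>
    B.add_mem (B.smul_mem _ (h.b_mem j)) (B.smul_mem _ (h.c_mem j))
  have hAB : ∀ i j i' j', p i j • a i + q i j • d i = p i' j' • a i' + q i' j' • d i' ∧
      p i j • b j + r i j • c j = p i' j' • b j' + r i' j' • c j' := fun i j i' j' =>
    eq_and_eq_of_add_eq_add h.disjoint (hA i j) (hA i' j') (hB i j) (hB i' j')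
      ((hpqr i j).symm.trans (hpqr i' j'))
  -- Along a fixed i (or j), independence of a i, d i (or b j, c j) shows that the coefficient p is
  -- the same. With equal p, the intersection property of w and w' gives x = p (w + w').
  have h1 : p 0 1 = p 0 0 := (eq_of_smul_add_eq (h.indep_left 0) (hAB 0 1 0 0).1).1
  have h2 : p 1 0 = p 0 0 := (eq_of_smul_add_eq (h.indep_right 0) (hAB 1 0 0 0).2).1
  have h3 := (hAB 0 0 1 0).1
  have h4 := (hAB 0 0 0 1).2
  rw [h2] at h3
  rw [h1] at h4
  rw [hpqr 0 0, hw _ _ _ h3, hw' _ _ _ h4, ← smul_add]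
  exact Submodule.smul_mem _ _ (Submodule.mem_span_singleton_self _)

theorem forall_indep_flip {x : Fin 2 → Vec} (hx : LinearIndependent ℝ ![x 0, x 1]) (i : Fin 2) :
    LinearIndependent ℝ ![x i, x (1 - i)] := by
  fin_cases i
  · exact hx
  · exact LinearIndependent.pair_symm_iff.1 hx

/-- A tangent meets its conic only at the point of contact (`eq_left`), and independence of a 0 and
a 1 keeps the two ends apart. -/
theorem sub_flip_notMem (h : P.IsCornerFrame A B a d b c) (hg : P.GenericBoundary) (i : Fin 2) :
    a (1 - i) - a i ∉ Submodule.span ℝ {d i} := by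
  intro hm
  have h1 := forall_indep_flip (h.generic hg).1 i
  rw [h.eq_left _ _ hm] at h1
  exact notMem_span_of_linearIndependent_pair h1 (Submodule.mem_span_singleton_self _)

theorem sub_flip_notMem' (h : P.IsCornerFrame A B a d b c) (hg : P.GenericBoundary) (j : Fin 2) :
    b (1 - j) - b j ∉ Submodule.span ℝ {c j} := by
  intro hm
  have h1 := forall_indep_flip (h.generic hg).2.1 j
  rw [h.eq_right _ _ hm] at h1
  exact notMem_span_of_linearIndependent_pair h1 (Submodule.mem_span_singleton_self _)

theorem finrank_focal_fst (h : P.IsCornerFrame A B a d b c) (hg : P.GenericBoundary)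
    (k i j : Fin 2) : finrank ℝ (P.tangent k i j ⊓ P.tangent k (1 - i) j : Submodule ℝ Vec) = 1 := by
  obtain ⟨ha, hb, hd, hc⟩ := h.generic hg
  revert k
  refine Fin.forall_fin_two.2 ⟨?_, ?_⟩
  · refine finrank_inf_eq_one (finrank_tangent _ _ _) (tangent_zero_inf_ne_bot _ _ _)
      (h.d_mem_tangent i j) ?_
    rw [h.tangent_zero]
    exact notMem_tangent_of_indep h.disjoint (h.a_mem _) (h.d_mem _) (h.d_mem _) (h.b_mem j)
      (h.b_ne_zero j) (LinearIndependent.pair_symm_iff.1 (forall_indep_flip hd i))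
  · refine finrank_inf_eq_one (finrank_tangent _ _ _) (inf_ne_bot_of_mem (h.c_ne_zero j)
      (h.c_mem_tangent i j) (h.c_mem_tangent _ j)) (h.add_mem_tangent 1 i j) ?_
    rw [h.tangent_one]
    exact notMem_conjugate_of_indep h.disjoint (h.a_mem _) (h.a_mem _) (h.b_mem j) (h.b_mem j)
      (h.c_mem j) (LinearIndependent.pair_symm_iff.1 (forall_indep_flip ha i))

theorem finrank_focal_snd (h : P.IsCornerFrame A B a d b c) (hg : P.GenericBoundary)
    (k i j : Fin 2) : finrank ℝ (P.tangent k i j ⊓ P.tangent k i (1 - j) : Submodule ℝ Vec) = 1 := by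
  obtain ⟨ha, hb, hd, hc⟩ := h.generic hg
  revert k
  refine Fin.forall_fin_two.2 ⟨?_, ?_⟩
  · refine finrank_inf_eq_one (finrank_tangent _ _ _) (inf_ne_bot_of_mem (h.d_ne_zero i)
      (h.d_mem_tangent i j) (h.d_mem_tangent i _)) (h.add_mem_tangent 0 i j) ?_
    rw [h.tangent_zero, add_comm (a i), add_comm (a i)]
    exact notMem_conjugate_of_indep h.disjoint.symm (h.b_mem _) (h.b_mem _) (h.a_mem i) (h.a_mem i)
      (h.d_mem i) (LinearIndependent.pair_symm_iff.1 (forall_indep_flip hb j))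
  · refine finrank_inf_eq_one (finrank_tangent _ _ _) (tangent_one_inf_ne_bot _ _ _)
      (h.c_mem_tangent i j) ?_
    rw [h.tangent_one, add_comm]
    exact notMem_tangent_of_indep h.disjoint.symm (h.b_mem _) (h.c_mem _) (h.c_mem _) (h.a_mem i)
      (h.a_ne_zero i) (LinearIndependent.pair_symm_iff.1 (forall_indep_flip hc j))

theorem finrank_focal_thd (h : P.IsCornerFrame A B a d b c) (k i j : Fin 2) :
    finrank ℝ (P.tangent k i j ⊓ P.tangent (1 - k) i j : Submodule ℝ Vec) = 1 := by
  have h0 : finrank ℝ (P.tangent 0 i j ⊓ P.tangent 1 i j : Submodule ℝ Vec) = 1 := by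
    refine finrank_inf_eq_one (finrank_tangent _ _ _) (inf_ne_bot_of_mem
      (add_ne_zero_of_disjoint h.disjoint (h.a_mem i) (h.b_mem j) (h.b_ne_zero j))
      (h.add_mem_tangent 0 i j) (h.add_mem_tangent 1 i j)) (h.d_mem_tangent i j) ?_
    rw [h.tangent_one, ← add_zero (d i)]
    exact notMem_conjugate_of_indep h.disjoint (h.a_mem _) (h.d_mem _) (h.b_mem j) B.zero_mem
      (h.c_mem j) (h.indep_left i)
  revert k
  refine Fin.forall_fin_two.2 ⟨h0, ?_⟩
  rw [inf_comm]
  exact h0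

theorem skew_fst_snd (h : P.IsCornerFrame A B a d b c) (hg : P.GenericBoundary) (k i j : Fin 2) :
    P.tangent k i j ⊓ P.tangent k (1 - i) (1 - j) = ⊥ := by
  obtain ⟨ha, hb, hd, hc⟩ := h.generic hg
  revert k
  refine Fin.forall_fin_two.2 ⟨?_, ?_⟩
  · rw [h.tangent_zero, h.tangent_zero]
    exact inf_eq_bot_of_opposite h.disjoint (h.a_mem _) (h.a_mem _) (h.d_mem _) (h.d_mem _)
      (h.b_mem _) (h.b_mem _) (forall_indep_flip hb j) (forall_indep_flip hd i)
  · rw [h.tangent_one, h.tangent_one, add_comm, add_comm (a (1 - i))]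
    exact inf_eq_bot_of_opposite h.disjoint.symm (h.b_mem _) (h.b_mem _) (h.c_mem _) (h.c_mem _)
      (h.a_mem _) (h.a_mem _) (forall_indep_flip ha i) (forall_indep_flip hc j)

theorem skew_fst_thd (h : P.IsCornerFrame A B a d b c) (hg : P.GenericBoundary) (k i j : Fin 2) :
    P.tangent k i j ⊓ P.tangent (1 - k) (1 - i) j = ⊥ := by
  have h0 : ∀ i, P.tangent 0 i j ⊓ P.tangent 1 (1 - i) j = ⊥ := by
    intro i
    rw [h.tangent_zero, h.tangent_one]
    exact inf_eq_bot_of_mixed h.disjoint (h.a_mem _) (h.a_mem _) (h.d_mem _) (h.b_mem _)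
      (h.c_mem _) (h.indep_right j) (h.sub_flip_notMem hg i)
  revert k
  refine Fin.forall_fin_two.2 ⟨h0 i, ?_⟩
  have h1 := h0 (1 - i)
  rw [sub_sub_cancel] at h1
  rw [inf_comm]
  exact h1

theorem skew_snd_thd (h : P.IsCornerFrame A B a d b c) (hg : P.GenericBoundary) (k i j : Fin 2) :
    P.tangent k i j ⊓ P.tangent (1 - k) i (1 - j) = ⊥ := by
  have h0 : ∀ j, P.tangent 1 i j ⊓ P.tangent 0 i (1 - j) = ⊥ := by
    intro j
    rw [h.tangent_zero, h.tangent_one, add_comm, add_comm (a i)]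
    exact inf_eq_bot_of_mixed h.disjoint.symm (h.b_mem _) (h.b_mem _) (h.c_mem _) (h.a_mem _)
      (h.d_mem _) (h.indep_left i) (h.sub_flip_notMem' hg j)
  revert k
  refine Fin.forall_fin_two.2 ⟨?_, h0 j⟩
  have h1 := h0 (1 - j)
  rw [sub_sub_cancel] at h1
  rw [inf_comm]
  exact h1

/-- The focal points are w + b j for the tangents of direction 0 and c j for those of direction 1,
all contained in B ⊔ span {w}. -/
theorem focal_planar_fst (h : P.IsCornerFrame A B a d b c) (hg : P.GenericBoundary) :
    ∃ W : Submodule ℝ Vec, finrank ℝ W = 3 ∧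
      ∀ k i j, P.tangent k i j ⊓ P.tangent k (1 - i) j ≤ W := by
  obtain ⟨ha, hb, hd, hc⟩ := h.generic hg
  obtain ⟨w, -, -, -, hw⟩ := exists_affine_inter h.finrank_left (h.a_mem 0)
    (h.a_mem 1) (h.d_mem 0) (h.d_mem 1) hd
  obtain ⟨W, hW, hW3⟩ := exists_le_finrank_eq (n := 3) (by rw [finrank_vec]; omega)
    (B ⊔ Submodule.span ℝ {w}) (by
      have h1 := Submodule.finrank_add_le_finrank_add_finrank B (Submodule.span ℝ {w})
      have h2 : finrank ℝ (Submodule.span ℝ {w}) ≤ 1 := by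
        simpa using finrank_span_le_card (R := ℝ) ({w} : Set Vec)
      rw [h.finrank_right] at h1
      omega)
  refine ⟨W, hW3, fun k i j => ?_⟩
  suffices h0 : P.tangent k 0 j ⊓ P.tangent k 1 j ≤ W by
    revert i
    refine Fin.forall_fin_two.2 ⟨h0, ?_⟩
    rw [inf_comm]
    exact h0
  refine le_trans ?_ hW
  revert k
  refine Fin.forall_fin_two.2 ⟨?_, ?_⟩
  · rw [h.tangent_zero, h.tangent_zero]
    exact inf_le_of_affine_inter h.disjoint (h.a_mem _) (h.a_mem _) (h.d_mem _) (h.d_mem _)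
      (h.b_mem _) (h.b_ne_zero j) hw
  · rw [h.tangent_one, h.tangent_one]
    exact (mem_of_mem_of_mem h.disjoint (h.a_mem _) (h.a_mem _) (h.b_mem _) (h.c_mem _) ha).trans
      le_sup_left

theorem focal_planar_snd (h : P.IsCornerFrame A B a d b c) (hg : P.GenericBoundary) :
    ∃ W : Submodule ℝ Vec, finrank ℝ W = 3 ∧
      ∀ k i j, P.tangent k i j ⊓ P.tangent k i (1 - j) ≤ W := by
  obtain ⟨ha, hb, hd, hc⟩ := h.generic hg
  obtain ⟨w, -, -, -, hw⟩ := exists_affine_inter h.finrank_right (h.b_mem 0)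
    (h.b_mem 1) (h.c_mem 0) (h.c_mem 1) hc
  obtain ⟨W, hW, hW3⟩ := exists_le_finrank_eq (n := 3) (by rw [finrank_vec]; omega)
    (A ⊔ Submodule.span ℝ {w}) (by
      have h1 := Submodule.finrank_add_le_finrank_add_finrank A (Submodule.span ℝ {w})
      have h2 : finrank ℝ (Submodule.span ℝ {w}) ≤ 1 := by
        simpa using finrank_span_le_card (R := ℝ) ({w} : Set Vec)
      rw [h.finrank_left] at h1
      omega)
  refine ⟨W, hW3, fun k i j => ?_⟩
  suffices h0 : P.tangent k i 0 ⊓ P.tangent k i 1 ≤ W by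
    revert j
    refine Fin.forall_fin_two.2 ⟨h0, ?_⟩
    rw [inf_comm]
    exact h0
  refine le_trans ?_ hW
  revert k
  refine Fin.forall_fin_two.2 ⟨?_, ?_⟩
  · rw [h.tangent_zero, h.tangent_zero, add_comm, add_comm (a i) (b 1)]
    exact (mem_of_mem_of_mem h.disjoint.symm (h.b_mem _) (h.b_mem _) (h.a_mem _) (h.d_mem _)
      hb).trans le_sup_left
  · rw [h.tangent_one, h.tangent_one, add_comm, add_comm (a i) (b 1)]
    exact inf_le_of_affine_inter h.disjoint.symm (h.b_mem _) (h.b_mem _) (h.c_mem _) (h.c_mem _)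
      (h.a_mem _) (h.a_ne_zero i) hw

/-- The two tangents at a corner meet in the vertex itself, so this is the coplanarity of the
vertices. -/
theorem focal_planar_thd (h : P.IsCornerFrame A B a d b c) :
    ∃ W : Submodule ℝ Vec, finrank ℝ W = 3 ∧
      ∀ k i j, P.tangent k i j ⊓ P.tangent (1 - k) i j ≤ W := by
  obtain ⟨W, hW3, hW⟩ := h.vertices_coplanar
  refine ⟨W, hW3, fun k i j => ?_⟩
  have h0 : P.tangent 0 i j ⊓ P.tangent 1 i j ≤ W := by
    refine le_trans ?_ (hW i j)
    rw [h.tangent_zero, h.tangent_one, h.vertex_eq]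
    exact inf_le_span_add h.disjoint (h.a_mem _) (h.d_mem _) (h.b_mem _) (h.c_mem _)
      (h.indep_left i)
  revert k
  refine Fin.forall_fin_two.2 ⟨h0, ?_⟩
  rw [inf_comm]
  exact h0

theorem tangentCube_flip_fst (ε : Fin 3 → Fin 2) :
    P.tangentCube (cubeFlip 0 ε) = P.tangent (ε 2) (1 - ε 0) (ε 1) := by
  simp [tangentCube, cubeFlip]

theorem tangentCube_flip_snd (ε : Fin 3 → Fin 2) :
    P.tangentCube (cubeFlip 1 ε) = P.tangent (ε 2) (ε 0) (1 - ε 1) := by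
  simp [tangentCube, cubeFlip]

theorem tangentCube_flip_thd (ε : Fin 3 → Fin 2) :
    P.tangentCube (cubeFlip 2 ε) = P.tangent (1 - ε 2) (ε 0) (ε 1) := by
  simp [tangentCube, cubeFlip]

theorem isFundamentalLineComplexCube (h : P.IsCornerFrame A B a d b c) (hg : P.GenericBoundary) :
    IsFundamentalLineComplexCube P.tangentCube where
  lines ε := finrank_tangent _ _ _
  torsal ε := by
    refine Fin.forall_fin_succ.2 ⟨?_, Fin.forall_fin_two.2 ⟨?_, ?_⟩⟩
    · rw [tangentCube_flip_fst]
      exact h.finrank_focal_fst hg (ε 2) (ε 0) (ε 1)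
    · change finrank ℝ (P.tangentCube ε ⊓ P.tangentCube (cubeFlip 1 ε) : Submodule ℝ Vec) = 1
      rw [tangentCube_flip_snd]
      exact h.finrank_focal_snd hg (ε 2) (ε 0) (ε 1)
    · change finrank ℝ (P.tangentCube ε ⊓ P.tangentCube (cubeFlip 2 ε) : Submodule ℝ Vec) = 1
      rw [tangentCube_flip_thd]
      exact h.finrank_focal_thd (ε 2) (ε 0) (ε 1)
  skew ε i j hij := by
    have h01 := h.skew_fst_snd hg (ε 2) (ε 0) (ε 1)
    have h02 := h.skew_fst_thd hg (ε 2) (ε 0) (ε 1)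
    have h12 := h.skew_snd_thd hg (ε 2) (ε 0) (ε 1)
    fin_cases i <;> fin_cases j <;> first
      | exact absurd rfl hij
      | simpa [tangentCube, cubeFlip] using h01
      | simpa [tangentCube, cubeFlip] using h02
      | simpa [tangentCube, cubeFlip] using h12
  focal_planar i := by
    fin_cases i
    · obtain ⟨W, hW3, hW⟩ := h.focal_planar_fst hg
      exact ⟨W, hW3, fun ε => by simpa [tangentCube, cubeFlip] using hW (ε 2) (ε 0) (ε 1)⟩
    · obtain ⟨W, hW3, hW⟩ := h.focal_planar_snd hg
      exact ⟨W, hW3, fun ε => by simpa [tangentCube, cubeFlip] using hW (ε 2) (ε 0) (ε 1)⟩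
    · obtain ⟨W, hW3, hW⟩ := h.focal_planar_thd
      exact ⟨W, hW3, fun ε => by simpa [tangentCube, cubeFlip] using hW (ε 2) (ε 0) (ε 1)⟩

end IsCornerFrame

theorem VerticesNotCollinear.not_le (hnc : P.VerticesNotCollinear) {l : Submodule ℝ Vec}
    (hl : finrank ℝ l ≤ 2) : ¬ ∀ i j, (P.vertex i j).submodule ≤ l := by
  intro h
  obtain ⟨W, hW, hW2⟩ := exists_le_finrank_eq (n := 2) (by rw [finrank_vec]; omega) l hl
  exact hnc ⟨W, hW2, fun i j => (h i j).trans hW⟩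

end SCPatch

/-! ### Assembly from the normal form. -/

theorem mainTheorem9 (P : SCPatch) (hskew : P.SkewCharacteristicLines) :
    -- (i) the vertices are coplanar
    (∃ W : Submodule ℝ Vec, finrank ℝ W = 3 ∧ ∀ i j, (P.vertex i j).submodule ≤ W) ∧
    -- (ii) perspectivity of opposite boundary curves from the Laplace points
    (P.VerticesNotCollinear →
      (∃ y₁ : RP3,
        join (P.vertex 0 0) (P.vertex 1 0) ⊓ join (P.vertex 0 1) (P.vertex 1 1) = y₁.submodule ∧
        ∀ v ∈ Icc P.b₀ P.b₁, PerspectiveFrom y₁ (P.f (P.a₀, v)) (P.f (P.a₁, v))) ∧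
      (∃ y₂ : RP3,
        join (P.vertex 0 0) (P.vertex 0 1) ⊓ join (P.vertex 1 0) (P.vertex 1 1) = y₂.submodule ∧
        ∀ u ∈ Icc P.a₀ P.a₁, PerspectiveFrom y₂ (P.f (u, P.b₀)) (P.f (u, P.b₁)))) ∧
    -- (iii) the boundary tangents of each direction intersect cyclically, and the eight tangents
    -- form a fundamental line complex cube
    ((∀ k, P.tangent k 0 0 ⊓ P.tangent k 1 0 ≠ ⊥ ∧ P.tangent k 1 0 ⊓ P.tangent k 1 1 ≠ ⊥ ∧
        P.tangent k 1 1 ⊓ P.tangent k 0 1 ≠ ⊥ ∧ P.tangent k 0 1 ⊓ P.tangent k 0 0 ≠ ⊥) ∧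
      (P.GenericBoundary → IsFundamentalLineComplexCube P.tangentCube)) ∧
    -- (iv) the four vertex tangent planes are concurrent
    ((∃ z : RP3, ∀ i j, z.submodule ≤ tangentPlane P.F (P.corner i j)) ∧
      (P.GenericBoundary → ∃ z : RP3, ⨅ i, ⨅ j, tangentPlane P.F (P.corner i j) = z.submodule)) := by
  obtain ⟨a, d, b, c, h⟩ := SCPatch.exists_coord hskew
  have hf := h.isCornerFrame
  refine ⟨hf.vertices_coplanar, fun hnc => ?_, ⟨hf.tangent_cyclic, hf.isFundamentalLineComplexCube⟩,
    hf.exists_common_point, hf.exists_unique_common_point⟩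
  have ha₀ := left_mem_Icc.2 P.a_lt.le
  have ha₁ := right_mem_Icc.2 P.a_lt.le
  have hb₀ := left_mem_Icc.2 P.b_lt.le
  have hb₁ := right_mem_Icc.2 P.b_lt.le
  have hcol : ∀ l : Submodule ℝ Vec, finrank ℝ l ≤ 2 → (P.vertex 0 0).submodule ≤ l →
      (P.vertex 1 0).submodule ≤ l → (P.vertex 0 1).submodule ≤ l →
      (P.vertex 1 1).submodule ≤ l → False := fun l hl h00 h10 h01 h11 =>
    hnc.not_le hl (Fin.forall_fin_two.2 ⟨Fin.forall_fin_two.2 ⟨h00, h01⟩,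
      Fin.forall_fin_two.2 ⟨h10, h11⟩⟩)
  have h00 : (P.vertex 0 0).submodule = _ := h.submodule_eq ha₀ hb₀
  have h10 : (P.vertex 1 0).submodule = _ := h.submodule_eq ha₁ hb₀
  have h01 : (P.vertex 0 1).submodule = _ := h.submodule_eq ha₀ hb₁
  have h11 : (P.vertex 1 1).submodule = _ := h.submodule_eq ha₁ hb₁
  refine ⟨?_, ?_⟩
  · obtain ⟨hne, y, hy, hinf⟩ := exists_laplacePoint h00 h10 h01 h11 hcol
    exact ⟨y, hinf, fun v hv => perspectiveFrom_of_span h.isCompl.disjoint (h.a_mem _ ha₀)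
      (h.a_mem _ ha₁) (h.b_mem v hv) ((h.indep_right v hv).ne_zero 0) hne hy
      (h.submodule_eq ha₀ hv) (h.submodule_eq ha₁ hv)⟩
  -- Exchanging the summands exchanges the two families, so the same lemma yields the second Laplace
  -- point b₁ - b₀.
  · rw [add_comm] at h00 h10 h01 h11
    obtain ⟨hne, y, hy, hinf⟩ := exists_laplacePoint h00 h01 h10 h11
      fun l hl g00 g01 g10 g11 => hcol l hl g00 g10 g01 g11
    exact ⟨y, hinf, fun u hu => perspectiveFrom_of_span h.isCompl.disjoint.symm (h.b_mem _ hb₀)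
      (h.b_mem _ hb₁) (h.a_mem u hu) ((h.indep_left u hu).ne_zero 0) hne hy
      (by rw [h.submodule_eq hu hb₀, add_comm]) (by rw [h.submodule_eq hu hb₁, add_comm])⟩
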